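/- For integers $d,s\ge 1$ let $X=X_{d,s}$ be a $d^2\times s$ random matrix whose entries are independent standard complex Gaussian variables $\mathcal N_{\mathbf C}(0,1)$ (independent real and imaginary parts, each centered of variance $1/2$). Let $W=XX^*$ be the associated Wishart matrix with parameters $(d^2,s)$, seen as an operator on $\mathbf C^d\otimes\mathbf C^d$ with entries $W_{ij,kl}$ ($1\le i,j,k,l\le d$), and let $R=R_{d^2,s}$ be its realignment, the $d^2\times d^2$ matrix with entries $R_{ik,jl}=W_{ij,kl}$. Let $E=|\psi\rangle\langle\psi|$ with $\psi=\frac1{\sqrt d}\sum_{i=1}^d e_i\otimes e_i$, and set $$Q=Q_{d^2,s}=\frac{1}{d\sqrt s}\,(R-dsE).$$ Let $\mathrm{Cat}_p=\frac1{p+1}\binom{2p}{p}$. Then for every integer $p\ge 0$ the random variable $\frac1{d^2}\mathrm{Tr}[(QQ^*)^p]$ is square-integrable, and as $d\to\infty$ and $s\to\infty$ jointly, with no constraint on their relative growth, $$\mathbf E\,\frac1{d^2}\mathrm{Tr}[(QQ^*)^p]\longrightarrow \mathrm{Cat}_p,\qquad \mathrm{Var}\,\frac1{d^2}\mathrm{Tr}[(QQ^*)^p]\longrightarrow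 0.$$ Moreover, the empirical singular value distribution of $Q$ converges in moments to the quarter-circle distribution $\mu_{qc}$, which has density $\frac{\sqrt{4-x^2}}{\pi}1_{[0,2]}(x)$: writing $\sigma_1(Q)\ge\dots\ge\sigma_{d^2}(Q)$ for the singular values of $Q$ and $\mu_Q=\frac1{d^2}\sum_{i=1}^{d^2}\delta_{\sigma_i(Q)}$, for every integer $k\ge 0$ the random variable $\int x^k\,d\mu_Q=\frac1{d^2}\sum_{i=1}^{d^2}\sigma_i(Q)^k$ is square-integrable and, in the same limit, $$\mathbf E\int x^k\,d\mu_Q\longrightarrow\int_0^2 x^k\,d\mu_{qc}(x),\qquad \mathrm{Var}\int x^k\,d\mu_Q\longrightarrow 0.$$ -/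

import Mathlib

open MeasureTheory ProbabilityTheory Filter Topology
open scoped Matrix ENNReal NNReal

noncomputable section

namespace RealignedWishart

/-- The standard complex Gaussian distribution `N_ℂ(0,1)`: real and imaginary parts are
independent real Gaussian variables with mean `0` and variance `1/2`. -/
def stdComplexGaussian : Measure ℂ :=
  ((gaussianReal 0 (1 / 2)).prod (gaussianReal 0 (1 / 2))).map (fun z : ℝ × ℝ => (⟨z.1, z.2⟩ : ℂ))

/-- `X` is a random matrix whose entries are independent standard complex Gaussian variables. -/
structure IsGaussianMatrix {Ω : Type*} [MeasurableSpace Ω] {m n : Type*}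
    (X : Ω → Matrix m n ℂ) (P : Measure Ω) : Prop where
  law : ∀ i j, HasLaw (fun ω => X ω i j) stdComplexGaussian P
  indep : iIndepFun (fun (ij : m × n) ω => X ω ij.1 ij.2) P

/-- The Wishart matrix `W = X X*` built from `X`. -/
def wishart {m n : Type*} [Fintype n] (X : Matrix m n ℂ) : Matrix m m ℂ := X * Xᴴ

/-- The realignment of a matrix on a tensor product: `(A^R)_{ik,jl} = A_{ij,kl}`. -/
def realign {m n : Type*} (A : Matrix (m × n) (m × n) ℂ) : Matrix (m × m) (n × n) ℂ :=
  Matrix.of fun ik jl => A (ik.1, jl.1) (ik.2, jl.2)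

/-- The vector `ψ = d^{-1/2} ∑ᵢ eᵢ ⊗ eᵢ` of `ℂ^d ⊗ ℂ^d`. -/
def maxEntangledVec (d : ℕ) : Fin d × Fin d → ℂ :=
  ((1 / √(d : ℝ) : ℝ) : ℂ) • ∑ i : Fin d, Pi.single (i, i) (1 : ℂ)

/-- The maximally entangled state `E = |ψ⟩⟨ψ|`. -/
def maxEntangledState (d : ℕ) : Matrix (Fin d × Fin d) (Fin d × Fin d) ℂ :=
  Matrix.vecMulVec (maxEntangledVec d) (star (maxEntangledVec d))

/-- `Q = (R - d s E) / (d √s)`, where `R` is the realignment of `W = X X*`. -/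
def Q {d s : ℕ} (X : Matrix (Fin d × Fin d) (Fin s) ℂ) :
    Matrix (Fin d × Fin d) (Fin d × Fin d) ℂ :=
  ((1 / (d * √(s : ℝ)) : ℝ) : ℂ) •
    (realign (wishart X) - ((d : ℂ) * (s : ℂ)) • maxEntangledState d)

/-- The trace of `(A A*)^p` is a real number, so taking its real part below loses nothing. -/
theorem ofReal_re_trace_pow {n : Type*} [Fintype n] [DecidableEq n] (A : Matrix n n ℂ) (p : ℕ) :
    ((((A * Aᴴ) ^ p).trace.re : ℝ) : ℂ) = ((A * Aᴴ) ^ p).trace := by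
  rw [← Complex.conj_eq_iff_re]
  have h : ((A * Aᴴ) ^ p)ᴴ = (A * Aᴴ) ^ p := by simp [Matrix.conjTranspose_pow]
  conv_rhs => rw [← h, Matrix.trace_conjTranspose]
  rfl

/-- The random variable `(1/d²) Tr[(Q Q*)^p]`. -/
def normTrace {d s : ℕ} (X : Matrix (Fin d × Fin d) (Fin s) ℂ) (p : ℕ) : ℝ :=
  (1 / (d : ℝ) ^ 2) * ((Q X * (Q X)ᴴ) ^ p).trace.re

/-- The singular values of a `d² × d²` matrix, in decreasing order, with multiplicity. -/
def singularValue {d : ℕ} (A : Matrix (Fin d × Fin d) (Fin d × Fin d) ℂ) (i : Fin (d ^ 2)) : ℝ :=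
  (Matrix.toEuclideanLin A).singularValues i

/-- The empirical singular value distribution `(1/d²) ∑ᵢ δ_{σᵢ(A)}` of a `d² × d²` matrix. -/
def empiricalSingularValueDist {d : ℕ} (A : Matrix (Fin d × Fin d) (Fin d × Fin d) ℂ) :
    Measure ℝ :=
  ((d : ℝ≥0∞) ^ 2)⁻¹ • ∑ i : Fin (d ^ 2), Measure.dirac (singularValue A i)

/-- The standard quarter-circle distribution, with density `√(4 - x²) / π` on `[0,2]`. -/
def quarterCircle : Measure ℝ :=
  volume.withDensity
    ((Set.Icc (0 : ℝ) 2).indicator fun x => ENNReal.ofReal (√(4 - x ^ 2) / Real.pi))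

/-- The `k`-th moment of the empirical singular value distribution of `Q`. -/
def singularValueMoment {d s : ℕ} (X : Matrix (Fin d × Fin d) (Fin s) ℂ) (k : ℕ) : ℝ :=
  ∫ x, x ^ k ∂(empiricalSingularValueDist (Q X))

end RealignedWishart

end

/-! Apply complex Gaussian integration by parts, E[z f] = E[∂f/∂z̄], to an entry of Q times a
polynomial f in the entries of Q. The result is a loop equation E[Q_c f] = s^{-1/2} E[D'_c f] +
E[D''_c f]. Subtracting dsE removes the contraction of the two factors of Q_c with each other. The
derivation D'' (`pairDeriv`) contracts Q_c with its conjugate entry, with weight d^{-2}, as for a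
Ginibre matrix with the real structure conj Q_{ik,jl} = Q_{ki,lj}. The derivation D' (`linkDeriv`)
replaces an entry by another one, with weight 1/d. Neither depends on s.

With D'' alone, the mixed moments of the normalized traces obey a recursion on the total degree. Its
leading part is the Catalan recursion, and its corrections carry factors d^{-2} and d^{-4}. The
mixed moments therefore tend to products of Catalan numbers. This factorization gives both the means
and the vanishing of the variances (`IsGinibreDeriv.isTraceRecursion`,
`tendsto_of_isTraceRecursion`).

The contribution of D' has to be negligible uniformly in d, and this follows from positivity. D' and
D'' preserve polynomials with nonnegative coefficients, so on these the expectation is nonnegative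
and bounded by the expectation E₁ of the case s = 1. Hence 0 ≤ E[D'_c f] ≤ E₁[D'_c f] ≤ E₁[Q_c f],
and the error in the trace recursion is at most s^{-1/2} times a mixed trace moment at s = 1
(`IsLoopFunctional.abs_sub_le`, `abs_loopRemainder_le`). At s = 1, adding the nonnegative mean back
to Q turns it into G ⊗ conj G with G a normalized complex Ginibre matrix. By positivity this only
increases moments, and the traces of G ⊗ conj G are squares of those of G, which the same recursion
bounds (`entryExpectation_le_ginibre`, `exists_bound_ginibrePoly`).

Even moments of singular values are traces. For the others, y ↦ √y ^ k is approximated by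
polynomials on [0,5], and the tail is controlled by one high even moment because Cat_n ≤ 4^n
(`exists_polynomial_approx`, `TendstoMeanSquare.of_approx`). -/

noncomputable section

namespace RealignedWishart

/-! ### Finite moments and Gaussian integration by parts -/

/-- A complex random variable all of whose moments are finite. -/
def HasAllMoments {Ω : Type*} [MeasurableSpace Ω] (f : Ω → ℂ) (μ : Measure Ω) : Prop :=
  ∀ n : ℕ, MemLp f n μ

namespace HasAllMoments

variable {Ω : Type*} [MeasurableSpace Ω] {μ : Measure Ω} {f g : Ω → ℂ}

theorem integrable (hf : HasAllMoments f μ) : Integrable f μ := by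
  simpa [memLp_one_iff_integrable] using hf 1

theorem add (hf : HasAllMoments f μ) (hg : HasAllMoments g μ) :
    HasAllMoments (fun ω => f ω + g ω) μ := fun n => (hf n).add (hg n)

theorem mul (hf : HasAllMoments f μ) (hg : HasAllMoments g μ) :
    HasAllMoments (fun ω => f ω * g ω) μ := by
  intro n
  have : ENNReal.HolderTriple ((n + n : ℕ) : ℝ≥0∞) ((n + n : ℕ) : ℝ≥0∞) (n : ℝ≥0∞) := by
    constructor
    rcases Nat.eq_zero_or_pos n with rfl | hn
    · simp
    · push_cast
      rw [← two_mul (n : ℝ≥0∞), ENNReal.mul_inv (by simp) (by simp), ← add_mul,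
        ENNReal.inv_two_add_inv_two, one_mul]
  exact (hg (n + n)).mul (hf (n + n))

theorem const [IsFiniteMeasure μ] (c : ℂ) : HasAllMoments (fun _ : Ω => c) μ :=
  fun _ => memLp_const c

theorem pow [IsFiniteMeasure μ] (hf : HasAllMoments f μ) (k : ℕ) :
    HasAllMoments (fun ω => f ω ^ k) μ := by
  induction k with
  | zero => simpa using const 1
  | succ k ih => simpa [pow_succ] using ih.mul hf

theorem star (hf : HasAllMoments f μ) : HasAllMoments (fun ω => (starRingEnd ℂ) (f ω)) μ :=
  fun n => (hf n).star

end HasAllMoments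

theorem hasAllMoments_ofReal_gaussianReal (v : ℝ≥0) :
    HasAllMoments (fun x : ℝ => (x : ℂ)) (gaussianReal 0 v) :=
  fun n => (memLp_id_gaussianReal' n (by simp)).ofReal

theorem hasDerivAt_gaussianPDFReal {v : ℝ≥0} (hv : v ≠ 0) (x : ℝ) :
    HasDerivAt (gaussianPDFReal 0 v) (-(x / v) * gaussianPDFReal 0 v x) x := by
  have hv' : (v : ℝ) ≠ 0 := by exact_mod_cast hv
  have h1 : HasDerivAt (fun x : ℝ => -(x - 0) ^ 2 / (2 * v)) (-(x / v)) x := by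
    have := (((hasDerivAt_id x).sub_const 0).pow 2).neg.div_const (2 * (v : ℝ))
    refine this.congr_deriv ?_
    simp only [id, sub_zero]
    field_simp
    norm_num
  have h2 := (h1.exp).const_mul (√(2 * Real.pi * v))⁻¹
  rw [gaussianPDFReal_def]
  refine h2.congr_deriv ?_
  ring

/-- Gaussian integration by parts. -/
theorem integral_mul_gaussianReal {v : ℝ≥0} (hv : v ≠ 0) {f f' : ℝ → ℂ}
    (hd : ∀ x, HasDerivAt f (f' x) x) (hf : HasAllMoments f (gaussianReal 0 v))
    (hf' : HasAllMoments f' (gaussianReal 0 v)) :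
    ∫ x, (x : ℂ) * f x ∂(gaussianReal 0 v) = (v : ℂ) * ∫ x, f' x ∂(gaussianReal 0 v) := by
  have hv' : (v : ℝ) ≠ 0 := by exact_mod_cast hv
  have hvc : ((v : ℝ) : ℂ) ≠ 0 := by exact_mod_cast hv'
  have key : ∀ g : ℝ → ℂ, HasAllMoments g (gaussianReal 0 v) →
      Integrable (fun x => gaussianPDFReal 0 v x • g x) volume := by
    intro g hg
    have h := hg.integrable
    rw [gaussianReal_of_var_ne_zero 0 hv] at h
    rw [integrable_withDensity_iff_integrable_smul₀' (measurable_gaussianPDF 0 v).aemeasurable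
      (by simp [gaussianPDF])] at h
    refine h.congr (Eventually.of_forall fun x => ?_)
    simp [gaussianPDF, ENNReal.toReal_ofReal (gaussianPDFReal_nonneg 0 v x)]
  have hxf := (hasAllMoments_ofReal_gaussianReal v).mul hf
  have hI := integral_mul_deriv_eq_deriv_mul_of_integrable (u := f) (u' := f')
    (v := fun x => ((gaussianPDFReal 0 v x : ℝ) : ℂ))
    (v' := fun x => ((-(x / v) * gaussianPDFReal 0 v x : ℝ) : ℂ))
    (fun x _ => hd x) (fun x _ => (hasDerivAt_gaussianPDFReal hv x).ofReal_comp) ?_ ?_ ?_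
  · rw [integral_gaussianReal_eq_integral_smul hv, integral_gaussianReal_eq_integral_smul hv]
    have h1 : ∫ x, gaussianPDFReal 0 v x • ((x : ℂ) * f x)
        = -(v : ℂ) * ∫ x, f x * ((-(x / v) * gaussianPDFReal 0 v x : ℝ) : ℂ) := by
      rw [← integral_const_mul]
      refine integral_congr_ae (Eventually.of_forall fun x => ?_)
      simp only [Complex.real_smul]
      push_cast
      field_simp
    rw [h1, hI]
    simp only [Complex.real_smul, neg_mul_neg]
    congr 1
    exact integral_congr_ae (Eventually.of_forall fun x => by simp [mul_comm])
  · refine ((key _ hxf).const_mul (-(1 / (v : ℂ)))).congr (Eventually.of_forall fun x => ?_)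
    simp only [Complex.real_smul, Pi.mul_apply]
    push_cast
    field_simp
  · refine (key _ hf').congr (Eventually.of_forall fun x => ?_)
    simp [mul_comm]
  · refine (key _ hf).congr (Eventually.of_forall fun x => ?_)
    simp [mul_comm]

instance : IsProbabilityMeasure stdComplexGaussian := by
  unfold stdComplexGaussian
  refine Measure.isProbabilityMeasure_map (Measurable.aemeasurable ?_)
  exact Complex.measurableEquivRealProd.symm.measurable

theorem measurable_mk_complex : Measurable (fun z : ℝ × ℝ => (⟨z.1, z.2⟩ : ℂ)) :=
  Complex.measurableEquivRealProd.symm.measurable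

theorem hasAllMoments_id_stdComplexGaussian : HasAllMoments (fun z : ℂ => z) stdComplexGaussian := by
  intro n
  unfold stdComplexGaussian
  rw [memLp_map_measure_iff (by fun_prop) measurable_mk_complex.aemeasurable]
  have h1 : HasAllMoments (fun z : ℝ × ℝ => (z.1 : ℂ))
      ((gaussianReal 0 (1 / 2)).prod (gaussianReal 0 (1 / 2))) :=
    fun n => (hasAllMoments_ofReal_gaussianReal (1 / 2) n).comp_fst _
  have h2 : HasAllMoments (fun z : ℝ × ℝ => (z.2 : ℂ))
      ((gaussianReal 0 (1 / 2)).prod (gaussianReal 0 (1 / 2))) :=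
    fun n => (hasAllMoments_ofReal_gaussianReal (1 / 2) n).comp_snd _
  refine (h1.add (h2.mul (.const Complex.I)) n).ae_eq (Eventually.of_forall fun z => ?_)
  apply Complex.ext <;> simp

/-- Joint moments of a standard complex Gaussian variable and its conjugate. -/
def complexGaussianMoment (a b : ℕ) : ℂ :=
  ∫ z, z ^ a * (starRingEnd ℂ) z ^ b ∂stdComplexGaussian

theorem integral_stdComplexGaussian {f : ℂ → ℂ} (hf : Measurable f) :
    ∫ z, f z ∂stdComplexGaussian
      = ∫ z : ℝ × ℝ, f ((z.1 : ℂ) + z.2 * Complex.I)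
          ∂((gaussianReal 0 (1 / 2)).prod (gaussianReal 0 (1 / 2))) := by
  unfold stdComplexGaussian
  rw [integral_map measurable_mk_complex.aemeasurable hf.aestronglyMeasurable]
  refine integral_congr_ae (Eventually.of_forall fun z => ?_)
  simp only [Complex.mk_eq_add_mul_I]

/-- Integrating by parts in x and in y turns the factor x + iy into (∂x + i∂y)/2 = ∂/∂z̄, which
kills z^a and differentiates the power of z̄. For b = 0 the truncated b - 1 is harmless, since its
coefficient vanishes. -/
theorem complexGaussianMoment_succ (a b : ℕ) :
    complexGaussianMoment (a + 1) b = b * complexGaussianMoment a (b - 1) := by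
  set γ : Measure ℝ := gaussianReal 0 (1 / 2) with hγ
  have hx := hasAllMoments_ofReal_gaussianReal (1 / 2)
  rw [← hγ] at hx
  have hv : (1 / 2 : ℝ≥0) ≠ 0 := by norm_num
  have hvc : (((1 / 2 : ℝ≥0) : ℝ) : ℂ) = 1 / 2 := by norm_num
  -- `F a b x y = (x + iy)^a (x - iy)^b`
  let F : ℕ → ℕ → ℝ → ℝ → ℂ := fun a b x y =>
    ((x : ℂ) + y * Complex.I) ^ a * ((x : ℂ) - y * Complex.I) ^ b
  have hconj : ∀ x y : ℝ, (starRingEnd ℂ) ((x : ℂ) + y * Complex.I) = (x : ℂ) - y * Complex.I := by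
    intro x y; simp [sub_eq_add_neg]
  have hFm : ∀ a b, complexGaussianMoment a b = ∫ z : ℝ × ℝ, F a b z.1 z.2 ∂(γ.prod γ) := by
    intro a b
    rw [complexGaussianMoment, integral_stdComplexGaussian (by fun_prop)]
    simp only [hconj, F, hγ]
  have hF1 : ∀ a b y, HasAllMoments (fun x => F a b x y) γ := fun a b y =>
    ((hx.add (.const _)).pow a).mul ((by simpa [sub_eq_add_neg] using hx.add (.const (-(y * Complex.I)))
      : HasAllMoments (fun x : ℝ => (x : ℂ) - y * Complex.I) γ).pow b)
  have hF2 : ∀ a b x, HasAllMoments (fun y => F a b x y) γ := fun a b x => by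
    have h1 : HasAllMoments (fun y : ℝ => (x : ℂ) + y * Complex.I) γ :=
      (HasAllMoments.const (x : ℂ)).add (hx.mul (.const Complex.I))
    have h2 : HasAllMoments (fun y : ℝ => (x : ℂ) - y * Complex.I) γ := by
      simpa [sub_eq_add_neg] using
        (HasAllMoments.const (x : ℂ)).add (hx.mul (.const (-Complex.I)))
    exact (h1.pow a).mul (h2.pow b)
  have e1 : HasAllMoments (fun z : ℝ × ℝ => (z.1 : ℂ)) (γ.prod γ) := fun n => (hx n).comp_fst _
  have e2 : HasAllMoments (fun z : ℝ × ℝ => (z.2 : ℂ)) (γ.prod γ) := fun n => (hx n).comp_snd _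
  have hF : ∀ a b, HasAllMoments (fun z : ℝ × ℝ => F a b z.1 z.2) (γ.prod γ) := fun a b => by
    have h1 := e1.add (e2.mul (.const Complex.I))
    have h2 : HasAllMoments (fun z : ℝ × ℝ => (z.1 : ℂ) - z.2 * Complex.I) (γ.prod γ) := by
      simpa [sub_eq_add_neg] using e1.add (e2.mul (.const (-Complex.I)))
    exact (h1.pow a).mul (h2.pow b)
  have dx : ∀ x y : ℝ, HasDerivAt (fun x => F a b x y)
      (a * F (a - 1) b x y + b * F a (b - 1) x y) x := by
    intro x y
    have h1 := ((hasDerivAt_id x).ofReal_comp.add_const ((y : ℂ) * Complex.I)).pow a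
    have h2 := ((hasDerivAt_id x).ofReal_comp.sub_const ((y : ℂ) * Complex.I)).pow b
    refine (h1.mul h2).congr_deriv ?_
    simp only [F, id, Complex.ofReal_one, Pi.pow_apply]
    ring
  have dy : ∀ x y : ℝ, HasDerivAt (fun y => F a b x y)
      (Complex.I * (a * F (a - 1) b x y - b * F a (b - 1) x y)) y := by
    intro x y
    have h0 := (hasDerivAt_id y).ofReal_comp.mul_const Complex.I
    have h1 := (h0.const_add (x : ℂ)).pow a
    have h2 := (h0.const_sub (x : ℂ)).pow b
    refine (h1.mul h2).congr_deriv ?_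
    simp only [F, id, Complex.ofReal_one, Pi.pow_apply]
    ring
  have ix : ∫ z : ℝ × ℝ, (z.1 : ℂ) * F a b z.1 z.2 ∂(γ.prod γ) =
      1 / 2 * ∫ z : ℝ × ℝ, (a * F (a - 1) b z.1 z.2 + b * F a (b - 1) z.1 z.2) ∂(γ.prod γ) := by
    rw [integral_prod_symm _ (e1.mul (hF a b)).integrable, integral_prod_symm _
      (((HasAllMoments.const _).mul (hF (a - 1) b)).add
        ((HasAllMoments.const _).mul (hF a (b - 1)))).integrable, ← integral_const_mul]
    refine integral_congr_ae (Eventually.of_forall fun y => ?_)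
    have := integral_mul_gaussianReal hv (fun x => dx x y) (hF1 a b y)
      (((HasAllMoments.const _).mul (hF1 (a - 1) b y)).add
        ((HasAllMoments.const _).mul (hF1 a (b - 1) y)))
    rw [hvc] at this
    exact this
  have iy : ∫ z : ℝ × ℝ, (z.2 : ℂ) * F a b z.1 z.2 ∂(γ.prod γ) =
      1 / 2 * ∫ z : ℝ × ℝ, Complex.I * (a * F (a - 1) b z.1 z.2 - b * F a (b - 1) z.1 z.2)
        ∂(γ.prod γ) := by
    have hs : ∀ x, HasAllMoments (fun y => Complex.I *
        (a * F (a - 1) b x y - b * F a (b - 1) x y)) γ := fun x => by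
      have := (HasAllMoments.const Complex.I).mul
        (((HasAllMoments.const (a : ℂ)).mul (hF2 (a - 1) b x)).add
          ((HasAllMoments.const (-b : ℂ)).mul (hF2 a (b - 1) x)))
      simpa [sub_eq_add_neg] using this
    have hs' : HasAllMoments (fun z : ℝ × ℝ => Complex.I *
        (a * F (a - 1) b z.1 z.2 - b * F a (b - 1) z.1 z.2)) (γ.prod γ) := by
      have := (HasAllMoments.const Complex.I).mul
        (((HasAllMoments.const (a : ℂ)).mul (hF (a - 1) b)).add
          ((HasAllMoments.const (-b : ℂ)).mul (hF a (b - 1))))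
      simpa [sub_eq_add_neg] using this
    rw [integral_prod _ (e2.mul (hF a b)).integrable, integral_prod _ hs'.integrable,
      ← integral_const_mul]
    refine integral_congr_ae (Eventually.of_forall fun x => ?_)
    have := integral_mul_gaussianReal hv (fun y => dy x y) (hF2 a b x) (hs x)
    rw [hvc] at this
    exact this
  have hsplit : ∀ z : ℝ × ℝ, F (a + 1) b z.1 z.2
      = (z.1 : ℂ) * F a b z.1 z.2 + Complex.I * ((z.2 : ℂ) * F a b z.1 z.2) := by
    intro z; simp only [F]; ring
  rw [hFm, hFm]
  simp only [hsplit]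
  rw [integral_add (e1.mul (hF a b)).integrable ((e2.mul (hF a b)).integrable.const_mul _),
    integral_const_mul, ix, iy, integral_const_mul,
    integral_add ((hF _ _).integrable.const_mul _) ((hF _ _).integrable.const_mul _),
    integral_sub ((hF _ _).integrable.const_mul _) ((hF _ _).integrable.const_mul _),
    integral_const_mul, integral_const_mul]
  linear_combination (1 / 2 : ℂ) * (a * ∫ z : ℝ × ℝ, F (a - 1) b z.1 z.2 ∂(γ.prod γ)
    - b * ∫ z : ℝ × ℝ, F a (b - 1) z.1 z.2 ∂(γ.prod γ)) * Complex.I_sq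

/-! ### Polynomials in independent complex Gaussian variables -/

section GaussianValue

variable {Ω V : Type*} {ζ : V → Ω → ℂ}

/-- The values of a family of complex variables and of their conjugates. -/
def gaussianValue (ζ : V → Ω → ℂ) (ω : Ω) (v : V × Bool) : ℂ :=
  if v.2 then (starRingEnd ℂ) (ζ v.1 ω) else ζ v.1 ω

/-- The value of a polynomial in a family of complex variables and their conjugates. -/
def gaussianEval (ζ : V → Ω → ℂ) (ω : Ω) : MvPolynomial (V × Bool) ℝ →ₐ[ℝ] ℂ :=
  MvPolynomial.aeval (gaussianValue ζ ω)

theorem gaussianEval_monomial [Fintype V] (ω : Ω) (u : V × Bool →₀ ℕ) (a : ℝ) :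
    gaussianEval ζ ω (MvPolynomial.monomial u a) = a * ∏ v, (ζ v ω ^ u (v, false) *
      (starRingEnd ℂ) (ζ v ω) ^ u (v, true)) := by
  rw [gaussianEval, MvPolynomial.aeval_monomial, Finsupp.prod_fintype _ _ (by simp),
    Fintype.prod_prod_type]
  simp [gaussianValue, mul_comm]

end GaussianValue

section GaussianFamily

variable {Ω : Type*} [MeasurableSpace Ω] {P : Measure Ω} {V : Type*} {ζ : V → Ω → ℂ}

theorem hasAllMoments_of_hasLaw [IsProbabilityMeasure P] {z : Ω → ℂ}
    (h : HasLaw z stdComplexGaussian P) : HasAllMoments z P := by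
  intro n
  have := hasAllMoments_id_stdComplexGaussian n
  rw [← h.map_eq, memLp_map_measure_iff (by fun_prop) h.aemeasurable] at this
  exact this

theorem hasAllMoments_gaussianEval [IsProbabilityMeasure P]
    (hl : ∀ v, HasLaw (ζ v) stdComplexGaussian P) (f : MvPolynomial (V × Bool) ℝ) :
    HasAllMoments (fun ω => gaussianEval ζ ω f) P := by
  induction f using MvPolynomial.induction_on with
  | C a => simpa [gaussianEval] using HasAllMoments.const (a : ℂ)
  | add p q hp hq => simpa using hp.add hq
  | mul_X p v hp =>
    simp only [map_mul]
    refine hp.mul ?_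
    rcases v with ⟨v, b⟩
    cases b
    · simpa [gaussianEval, gaussianValue] using hasAllMoments_of_hasLaw (hl v)
    · simpa [gaussianEval, gaussianValue] using (hasAllMoments_of_hasLaw (hl v)).star

theorem integral_gaussianEval_monomial [Fintype V]
    (hl : ∀ v, HasLaw (ζ v) stdComplexGaussian P) (hi : iIndepFun ζ P)
    (u : V × Bool →₀ ℕ) (a : ℝ) :
    ∫ ω, gaussianEval ζ ω (MvPolynomial.monomial u a) ∂P =
      a * ∏ v, complexGaussianMoment (u (v, false)) (u (v, true)) := by
  simp only [gaussianEval_monomial]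
  rw [integral_const_mul]
  congr 1
  have hm : ∀ v, Continuous (fun z : ℂ => z ^ u (v, false) * (starRingEnd ℂ) z ^ u (v, true)) :=
    fun v => (continuous_id.pow _).mul (Complex.continuous_conj.pow _)
  refine (hi.integral_fun_prod_comp (fun v => (hl v).aemeasurable)
    (fun v => (hm v).aestronglyMeasurable)).trans ?_
  refine Finset.prod_congr rfl fun v _ => ?_
  exact (hl v).integral_comp (hm v).aestronglyMeasurable

/-- Integration by parts for polynomials in independent complex Gaussian variables. -/
theorem integral_gaussianEval_X_mul [Fintype V] [IsProbabilityMeasure P]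
    (hl : ∀ v, HasLaw (ζ v) stdComplexGaussian P) (hi : iIndepFun ζ P)
    (v : V) (f : MvPolynomial (V × Bool) ℝ) :
    ∫ ω, gaussianEval ζ ω (MvPolynomial.X (v, false) * f) ∂P =
      ∫ ω, gaussianEval ζ ω (MvPolynomial.pderiv (v, true) f) ∂P := by
  classical
  have hint := fun f => (hasAllMoments_gaussianEval hl f).integrable
  induction f using MvPolynomial.induction_on' with
  | add p q hp hq =>
    simp only [mul_add, map_add (MvPolynomial.pderiv (R := ℝ) (v, true)), map_add (gaussianEval ζ _)]
    rw [integral_add (hint _) (hint _), integral_add (hint _) (hint _), hp, hq]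
  | monomial u a =>
    -- By independence both sides factor over the variables. Only the factor of `v` differs, and
    -- there the claim is `complexGaussianMoment_succ`.
    rw [MvPolynomial.pderiv_monomial, MvPolynomial.X, MvPolynomial.monomial_mul, one_mul,
      integral_gaussianEval_monomial hl hi, integral_gaussianEval_monomial hl hi,
      Fintype.prod_eq_mul_prod_compl v, Fintype.prod_eq_mul_prod_compl v]
    have h1 : ∀ w ∈ ({v}ᶜ : Finset V), w ≠ v := fun w hw => by simpa using hw
    rw [Finset.prod_congr rfl (g := fun w => complexGaussianMoment (u (w, false)) (u (w, true)))
      (fun w hw => by simp [(h1 w hw).symm])]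
    conv_rhs => rw [Finset.prod_congr rfl
      (g := fun w => complexGaussianMoment (u (w, false)) (u (w, true)))
      (fun w hw => by simp [(h1 w hw).symm])]
    simp only [Finsupp.add_apply, Finsupp.tsub_apply, Finsupp.single_apply, Prod.mk.injEq,
      Bool.false_eq_true, Bool.true_eq_false, and_false, if_true, if_false, zero_add,
      tsub_zero]
    rw [add_comm 1 (u (v, false)), complexGaussianMoment_succ]
    push_cast
    ring

end GaussianFamily

/-! ### Positivity and comparison for loop functionals -/

section PositivePolynomials

variable {σ : Type*}

/-- Polynomials of degree at most `n` with nonnegative coefficients. -/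
inductive PosPoly : ℕ → MvPolynomial σ ℝ → Prop
  | const (n : ℕ) {a : ℝ} (ha : 0 ≤ a) : PosPoly n (MvPolynomial.C a)
  | add {n : ℕ} {f g : MvPolynomial σ ℝ} (hf : PosPoly n f) (hg : PosPoly n g) : PosPoly n (f + g)
  | X_mul {n : ℕ} (b : σ) {f : MvPolynomial σ ℝ} (hf : PosPoly n f) :
      PosPoly (n + 1) (MvPolynomial.X b * f)

namespace PosPoly

variable {n m : ℕ} {f g : MvPolynomial σ ℝ}

theorem succ (hf : PosPoly n f) : PosPoly (n + 1) f := by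
  induction hf with
  | const n ha => exact const _ ha
  | add _ _ h1 h2 => exact h1.add h2
  | X_mul b _ h => exact h.X_mul b

theorem mono (h : n ≤ m) (hf : PosPoly n f) : PosPoly m f := by
  induction h with
  | refl => exact hf
  | step _ ih => exact ih.succ

theorem const_mul {a : ℝ} (ha : 0 ≤ a) (hf : PosPoly n f) : PosPoly n (MvPolynomial.C a * f) := by
  induction hf with
  | const n hb => rw [← map_mul]; exact const _ (mul_nonneg ha hb)
  | add _ _ h1 h2 => rw [mul_add]; exact h1.add h2
  | X_mul b _ h => rw [mul_left_comm]; exact h.X_mul b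

theorem mul (hf : PosPoly n f) (hg : PosPoly m g) : PosPoly (n + m) (f * g) := by
  induction hf with
  | const n ha => exact (hg.const_mul ha).mono (by omega)
  | add _ _ h1 h2 => rw [add_mul]; exact h1.add h2
  | X_mul b _ h => rw [mul_assoc]; exact (h.X_mul b).mono (by omega)

theorem var (b : σ) : PosPoly 1 (MvPolynomial.X b : MvPolynomial σ ℝ) := by
  simpa using (const 0 (zero_le_one' ℝ)).X_mul b

theorem zero (n : ℕ) : PosPoly n (0 : MvPolynomial σ ℝ) := by
  simpa using (const n le_rfl : PosPoly n (MvPolynomial.C (0 : ℝ)))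

/-- Such a derivation does not raise the degree bound, so the loop equation, which first strips off
one variable, lowers it. Inductions on the degree rest on this. -/
theorem derivation {D : Derivation ℝ (MvPolynomial σ ℝ) (MvPolynomial σ ℝ)}
    (hD : ∀ b, PosPoly 1 (D (MvPolynomial.X b))) (hf : PosPoly n f) : PosPoly n (D f) := by
  induction hf with
  | const n ha => rw [MvPolynomial.derivation_C]; exact zero n
  | add _ _ h1 h2 => rw [map_add]; exact h1.add h2
  | @X_mul n b f hf h =>
    rw [Derivation.leibniz, smul_eq_mul, smul_eq_mul]
    exact (h.X_mul b).add (hf.mul (hD b))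

end PosPoly

/-- Polynomials with nonnegative coefficients. -/
def IsPos (f : MvPolynomial σ ℝ) : Prop := ∃ n, PosPoly n f

namespace IsPos

variable {f g : MvPolynomial σ ℝ}

theorem add (hf : IsPos f) (hg : IsPos g) : IsPos (f + g) := by
  obtain ⟨n, hn⟩ := hf
  obtain ⟨m, hm⟩ := hg
  exact ⟨max n m, (hn.mono (le_max_left _ _)).add (hm.mono (le_max_right _ _))⟩

theorem mul (hf : IsPos f) (hg : IsPos g) : IsPos (f * g) := by
  obtain ⟨n, hn⟩ := hf
  obtain ⟨m, hm⟩ := hg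
  exact ⟨n + m, hn.mul hm⟩

theorem const {a : ℝ} (ha : 0 ≤ a) : IsPos (MvPolynomial.C a : MvPolynomial σ ℝ) :=
  ⟨0, .const 0 ha⟩

theorem zero : IsPos (0 : MvPolynomial σ ℝ) := ⟨0, .zero 0⟩

theorem one : IsPos (1 : MvPolynomial σ ℝ) := by simpa using const (σ := σ) (zero_le_one' ℝ)

theorem var (b : σ) : IsPos (MvPolynomial.X b : MvPolynomial σ ℝ) := ⟨1, .var b⟩

theorem sum {κ : Type*} (S : Finset κ) {f : κ → MvPolynomial σ ℝ} (h : ∀ k ∈ S, IsPos (f k)) :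
    IsPos (∑ k ∈ S, f k) :=
  Finset.sum_induction f IsPos (fun _ _ => IsPos.add) zero h

theorem list_prod {L : List (MvPolynomial σ ℝ)} (h : ∀ f ∈ L, IsPos f) : IsPos L.prod := by
  induction L with
  | nil => simpa using one
  | cons f L ih =>
    rw [List.prod_cons]
    exact (h f (by simp)).mul (ih fun g hg => h g (by simp [hg]))

theorem matrix_mul {n : Type*} [Fintype n] {A B : Matrix n n (MvPolynomial σ ℝ)}
    (hA : ∀ i j, IsPos (A i j)) (hB : ∀ i j, IsPos (B i j)) (i j : n) : IsPos ((A * B) i j) := by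
  rw [Matrix.mul_apply]
  exact sum _ fun k _ => (hA i k).mul (hB k j)

theorem matrix_pow {n : Type*} [Fintype n] [DecidableEq n] {A : Matrix n n (MvPolynomial σ ℝ)}
    (hA : ∀ i j, IsPos (A i j)) (p : ℕ) : ∀ i j, IsPos ((A ^ p) i j) := by
  induction p with
  | zero =>
    intro i j
    rw [pow_zero, Matrix.one_apply]
    split_ifs
    · exact one
    · exact zero
  | succ p ih => rw [pow_succ]; exact matrix_mul ih hA

end IsPos

/-- A normalized functional satisfying the loop equations of the derivations `r • D' + D''`. -/
structure IsLoopFunctional (D' D'' : σ → Derivation ℝ (MvPolynomial σ ℝ) (MvPolynomial σ ℝ))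
    (r : ℝ) (E : MvPolynomial σ ℝ →ₗ[ℝ] ℝ) : Prop where
  map_one : E 1 = 1
  loop : ∀ c f, E (MvPolynomial.X c * f) = r * E (D' c f) + E (D'' c f)

variable {D' D'' : σ → Derivation ℝ (MvPolynomial σ ℝ) (MvPolynomial σ ℝ)} {r : ℝ}
  {E E₁ : MvPolynomial σ ℝ →ₗ[ℝ] ℝ}

theorem IsLoopFunctional.map_C (hE : IsLoopFunctional D' D'' r E) (a : ℝ) :
    E (MvPolynomial.C a) = a := by
  rw [← mul_one (MvPolynomial.C a), ← MvPolynomial.smul_eq_C_mul, map_smul, hE.map_one]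
  simp

/-- The loop equation replaces `X c * f` by images of `f` that again have nonnegative coefficients
and a smaller degree bound. The outer induction is on that bound; the inner one, on how `f` is
built, handles sums. -/
theorem IsLoopFunctional.nonneg (hE : IsLoopFunctional D' D'' r E) (hr : 0 ≤ r)
    (h' : ∀ c b, PosPoly 1 (D' c (MvPolynomial.X b)))
    (h'' : ∀ c b, PosPoly 1 (D'' c (MvPolynomial.X b)))
    {f : MvPolynomial σ ℝ} (hf : IsPos f) : 0 ≤ E f := by
  suffices ∀ N n (f : MvPolynomial σ ℝ), PosPoly n f → n ≤ N → 0 ≤ E f by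
    obtain ⟨n, hn⟩ := hf
    exact this n n f hn le_rfl
  intro N
  induction N with
  | zero =>
    intro n f hf hn
    induction hf with
    | const n ha => rwa [hE.map_C]
    | add _ _ h1 h2 => rw [map_add]; exact add_nonneg (h1 hn) (h2 hn)
    | X_mul b _ _ => omega
  | succ N ih =>
    intro n f hf hn
    induction hf with
    | const n ha => rwa [hE.map_C]
    | add _ _ h1 h2 => rw [map_add]; exact add_nonneg (h1 hn) (h2 hn)
    | @X_mul n b f hf _ =>
      rw [hE.loop]
      exact add_nonneg (mul_nonneg hr (ih n _ (hf.derivation (h' b)) (by omega)))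
        (ih n _ (hf.derivation (h'' b)) (by omega))

/-- The induction is that of `IsLoopFunctional.nonneg`. Replacing the weight `r` by 1 goes in the
right direction because `E (D' c f)` is nonnegative. -/
theorem IsLoopFunctional.le (hE : IsLoopFunctional D' D'' r E) (hE₁ : IsLoopFunctional D' D'' 1 E₁)
    (hr : 0 ≤ r) (hr1 : r ≤ 1)
    (h' : ∀ c b, PosPoly 1 (D' c (MvPolynomial.X b)))
    (h'' : ∀ c b, PosPoly 1 (D'' c (MvPolynomial.X b)))
    {f : MvPolynomial σ ℝ} (hf : IsPos f) : E f ≤ E₁ f := by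
  suffices ∀ N n (f : MvPolynomial σ ℝ), PosPoly n f → n ≤ N → E f ≤ E₁ f by
    obtain ⟨n, hn⟩ := hf
    exact this n n f hn le_rfl
  intro N
  induction N with
  | zero =>
    intro n f hf hn
    induction hf with
    | const n ha => rw [hE.map_C, hE₁.map_C]
    | add _ _ h1 h2 => rw [map_add, map_add]; exact add_le_add (h1 hn) (h2 hn)
    | X_mul b _ _ => omega
  | succ N ih =>
    intro n f hf hn
    induction hf with
    | const n ha => rw [hE.map_C, hE₁.map_C]
    | add _ _ h1 h2 => rw [map_add, map_add]; exact add_le_add (h1 hn) (h2 hn)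
    | @X_mul n b f hf _ =>
      rw [hE.loop, hE₁.loop]
      have h0 := hE.nonneg hr h' h'' ⟨n, hf.derivation (h' b)⟩
      have h1 := ih n _ (hf.derivation (h' b)) (by omega)
      exact add_le_add (mul_le_mul hr1 h1 h0 zero_le_one)
        (ih n _ (hf.derivation (h'' b)) (by omega))

/-- The difference is r E(D' f), and 0 ≤ E(D' f) ≤ E₁(D' f) ≤ E₁(D' f) + E₁(D'' f) = E₁(X_c f). The
bound no longer mentions D', so its combinatorics never has to be analysed. -/
theorem IsLoopFunctional.abs_sub_le (hE : IsLoopFunctional D' D'' r E)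
    (hE₁ : IsLoopFunctional D' D'' 1 E₁) (hr : 0 ≤ r) (hr1 : r ≤ 1)
    (h' : ∀ c b, PosPoly 1 (D' c (MvPolynomial.X b)))
    (h'' : ∀ c b, PosPoly 1 (D'' c (MvPolynomial.X b)))
    {f : MvPolynomial σ ℝ} (hf : IsPos f) (c : σ) :
    |E (MvPolynomial.X c * f) - E (D'' c f)| ≤ r * E₁ (MvPolynomial.X c * f) := by
  obtain ⟨n, hn⟩ := hf
  have p' : IsPos (D' c f) := ⟨n, hn.derivation (h' c)⟩
  have p'' : IsPos (D'' c f) := ⟨n, hn.derivation (h'' c)⟩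
  rw [hE.loop, hE₁.loop, add_sub_cancel_right, abs_of_nonneg
    (mul_nonneg hr (hE.nonneg hr h' h'' p'))]
  refine mul_le_mul_of_nonneg_left ?_ hr
  have h1 := hE.le hE₁ hr hr1 h' h'' p'
  have h2 := hE₁.nonneg zero_le_one h' h'' p''
  linarith

/-- Translation of the variables. -/
def shift (δ : σ → ℝ) : MvPolynomial σ ℝ →ₐ[ℝ] MvPolynomial σ ℝ :=
  MvPolynomial.aeval fun b => MvPolynomial.X b + MvPolynomial.C (δ b)

/-- Expanding around a nonnegative translation only adds nonnegative terms. Together with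
`IsLoopFunctional.nonneg` this bounds a moment of the centred matrix by that of the matrix with its
mean restored. -/
theorem IsPos.shift_sub {δ : σ → ℝ} (hδ : ∀ b, 0 ≤ δ b) {f : MvPolynomial σ ℝ} (hf : IsPos f) :
    IsPos (shift δ f - f) := by
  obtain ⟨n, hn⟩ := hf
  induction hn with
  | const n ha => simpa [shift] using zero
  | @add n f g _ _ h1 h2 =>
    have : shift δ (f + g) - (f + g) = (shift δ f - f) + (shift δ g - g) := by
      rw [map_add]; ring
    rw [this]; exact h1.add h2
  | @X_mul n b f hf h =>
    have h1 : shift δ (MvPolynomial.X b) = MvPolynomial.X b + MvPolynomial.C (δ b) := by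
      simp [shift]
    have h2 : shift δ (MvPolynomial.X b * f) - MvPolynomial.X b * f =
        MvPolynomial.X b * (shift δ f - f)
          + MvPolynomial.C (δ b) * ((shift δ f - f) + f) := by
      rw [map_mul, h1]; ring
    rw [h2]
    exact ((var b).mul h).add ((const (hδ b)).mul (h.add ⟨n, hf⟩))

end PositivePolynomials

/-! ### Loop equations for the entries of Q -/

section Expectation

variable {Ω : Type*} [MeasurableSpace Ω] {P : Measure Ω} [IsProbabilityMeasure P]
  {V : Type*} {ζ : V → Ω → ℂ}

/-- The expectation of (the real part of) a polynomial in Gaussian variables. -/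
def gaussianExpectation (hl : ∀ v, HasLaw (ζ v) stdComplexGaussian P) :
    MvPolynomial (V × Bool) ℝ →ₗ[ℝ] ℝ where
  toFun f := (∫ ω, gaussianEval ζ ω f ∂P).re
  map_add' f g := by
    simp only [map_add]
    rw [integral_add (hasAllMoments_gaussianEval hl f).integrable
      (hasAllMoments_gaussianEval hl g).integrable, Complex.add_re]
  map_smul' a f := by
    simp only [map_smul, Complex.real_smul]
    rw [integral_const_mul]
    simp

theorem gaussianExpectation_one (hl : ∀ v, HasLaw (ζ v) stdComplexGaussian P) :
    gaussianExpectation hl 1 = 1 := by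
  simp [gaussianExpectation]

theorem gaussianExpectation_X_mul [Fintype V] (hl : ∀ v, HasLaw (ζ v) stdComplexGaussian P)
    (hi : iIndepFun ζ P) (v : V) (f : MvPolynomial (V × Bool) ℝ) :
    gaussianExpectation hl (MvPolynomial.X (v, false) * f) =
      gaussianExpectation hl (MvPolynomial.pderiv (v, true) f) :=
  congrArg Complex.re (integral_gaussianEval_X_mul hl hi v f)

end Expectation

section LoopEquations

variable {d s : ℕ}

/-- Indices of the entries of a `d² × d²` matrix. -/
abbrev EntryIdx (d : ℕ) : Type := (Fin d × Fin d) × (Fin d × Fin d)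

/-- The polynomial, in the Gaussian entries of `X`, giving the entry `c` of `Q`. -/
def entryPoly (d s : ℕ) (c : EntryIdx d) : MvPolynomial (((Fin d × Fin d) × Fin s) × Bool) ℝ :=
  MvPolynomial.C (1 / (d * √(s : ℝ))) *
    ((∑ t : Fin s, MvPolynomial.X (((c.1.1, c.2.1), t), false) *
        MvPolynomial.X (((c.1.2, c.2.2), t), true))
      - MvPolynomial.C (if c.1.1 = c.1.2 ∧ c.2.1 = c.2.2 then (s : ℝ) else 0))

/-- Substitution of the entries of `Q` into a polynomial. -/
def entrySubst (d s : ℕ) : MvPolynomial (EntryIdx d) ℝ →ₐ[ℝ]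
    MvPolynomial (((Fin d × Fin d) × Fin s) × Bool) ℝ :=
  MvPolynomial.aeval (entryPoly d s)

/-- The part of the loop equation which is of lower order in `s`. -/
def linkDeriv (d : ℕ) (c : EntryIdx d) :
    Derivation ℝ (MvPolynomial (EntryIdx d) ℝ) (MvPolynomial (EntryIdx d) ℝ) :=
  MvPolynomial.mkDerivation ℝ fun b => if b.1.2 = c.1.1 ∧ b.2.2 = c.2.1 then
    MvPolynomial.C (1 / (d : ℝ)) * MvPolynomial.X ((b.1.1, c.1.2), (b.2.1, c.2.2)) else 0

/-- The leading part of the loop equation, that of a real Ginibre matrix. -/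
def pairDeriv (d : ℕ) (c : EntryIdx d) :
    Derivation ℝ (MvPolynomial (EntryIdx d) ℝ) (MvPolynomial (EntryIdx d) ℝ) :=
  MvPolynomial.mkDerivation ℝ fun b => if b.1 = c.1.swap ∧ b.2 = c.2.swap then
    MvPolynomial.C (1 / (d : ℝ) ^ 2) else 0

theorem posPoly_linkDeriv_X (c b : EntryIdx d) : PosPoly 1 (linkDeriv d c (MvPolynomial.X b)) := by
  rw [linkDeriv, MvPolynomial.mkDerivation_X]
  split_ifs
  · exact (PosPoly.var _).const_mul (by positivity)
  · exact .zero 1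

theorem posPoly_pairDeriv_X (c b : EntryIdx d) : PosPoly 1 (pairDeriv d c (MvPolynomial.X b)) := by
  rw [pairDeriv, MvPolynomial.mkDerivation_X]
  split_ifs
  · exact .const 1 (by positivity)
  · exact .zero 1

/-- Both sides obey the Leibniz rule in `f`, so it suffices to treat one variable. There the
derivative removes the conjugated factor of the entry, and the sum over `t` builds a new uncentred
entry. Writing it as a centred entry plus its mean separates the link term from the pair term. -/
theorem sum_mul_pderiv_entrySubst (hd : 0 < d) (hs : 0 < s) (c : EntryIdx d)
    (f : MvPolynomial (EntryIdx d) ℝ) :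
    MvPolynomial.C (1 / (d * √(s : ℝ))) *
      ∑ t : Fin s, MvPolynomial.X (((c.1.2, c.2.2), t), true) *
        MvPolynomial.pderiv (((c.1.1, c.2.1), t), true) (entrySubst d s f) =
    entrySubst d s ((1 / √(s : ℝ)) • linkDeriv d c f + pairDeriv d c f) := by
  have hd' : (d : ℝ) ≠ 0 := by positivity
  have hs' : √(s : ℝ) ≠ 0 := by positivity
  induction f using MvPolynomial.induction_on with
  | C a => simp [entrySubst, linkDeriv, pairDeriv]
  | add p q hp hq =>
    simp only [map_add, mul_add, smul_add, Finset.sum_add_distrib] at hp hq ⊢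
    rw [hp, hq]; ring
  | mul_X p b hp =>
    have key : MvPolynomial.C (1 / (d * √(s : ℝ))) *
      ∑ t : Fin s, MvPolynomial.X (((c.1.2, c.2.2), t), true) *
        MvPolynomial.pderiv (((c.1.1, c.2.1), t), true) (entryPoly d s b) =
        entrySubst d s ((1 / √(s : ℝ)) • linkDeriv d c (MvPolynomial.X b)
          + pairDeriv d c (MvPolynomial.X b)) := by
      have hpd : ∀ t : Fin s, MvPolynomial.pderiv (((c.1.1, c.2.1), t), true) (entryPoly d s b) =
          if b.1.2 = c.1.1 ∧ b.2.2 = c.2.1 then MvPolynomial.C (1 / (d * √(s : ℝ))) *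
            MvPolynomial.X (((b.1.1, b.2.1), t), false) else 0 := by
        intro t
        rw [entryPoly, Derivation.leibniz, MvPolynomial.pderiv_C, smul_zero, add_zero, smul_eq_mul,
          map_sub, MvPolynomial.pderiv_C, sub_zero, map_sum]
        simp only [Derivation.leibniz, MvPolynomial.pderiv_X, smul_eq_mul, Pi.single_apply,
          Prod.mk.injEq, Bool.false_eq_true, and_false, if_false, mul_zero, add_zero, and_true]
        split_ifs with h
        · simp [h.1, h.2]
        · have : ∀ u : Fin s, ¬ ((b.1.2 = c.1.1 ∧ b.2.2 = c.2.1) ∧ u = t) := fun u hu => h hu.1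
          simp [this]
      simp only [hpd, linkDeriv, pairDeriv, MvPolynomial.mkDerivation_X]
      by_cases h : b.1.2 = c.1.1 ∧ b.2.2 = c.2.1
      -- Under the link condition, the pairing condition says exactly that the new entry has nonzero
      -- mean.
      · have h2 : (b.1 = c.1.swap ∧ b.2 = c.2.swap) ↔ (b.1.1 = c.1.2 ∧ b.2.1 = c.2.2) := by
          rw [Prod.ext_iff, Prod.ext_iff]
          simp only [Prod.fst_swap, Prod.snd_swap]
          tauto
        simp only [if_pos h, h2]
        have hX : entrySubst d s (MvPolynomial.X ((b.1.1, c.1.2), (b.2.1, c.2.2))) =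
            MvPolynomial.C (1 / (d * √(s : ℝ))) *
            ((∑ t : Fin s, MvPolynomial.X (((b.1.1, b.2.1), t), false) *
                MvPolynomial.X (((c.1.2, c.2.2), t), true))
            - MvPolynomial.C (if b.1.1 = c.1.2 ∧ b.2.1 = c.2.2 then (s : ℝ) else 0)) := by
          simp [entrySubst, entryPoly]
        have hC : ∀ a, entrySubst d s (MvPolynomial.C a) = MvPolynomial.C a := by
          intro a; simp [entrySubst]
        have hite : entrySubst d s (if b.1.1 = c.1.2 ∧ b.2.1 = c.2.2 then
            MvPolynomial.C (1 / (d : ℝ) ^ 2) else 0) = MvPolynomial.C (1 / (d : ℝ) ^ 2 *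
            if b.1.1 = c.1.2 ∧ b.2.1 = c.2.2 then 1 else 0) := by
          split_ifs <;> simp [hC]
        have hite2 : (if b.1.1 = c.1.2 ∧ b.2.1 = c.2.2 then (s : ℝ) else 0) =
            √(s : ℝ) ^ 2 * (if b.1.1 = c.1.2 ∧ b.2.1 = c.2.2 then 1 else 0) := by
          rw [Real.sq_sqrt (by positivity)]; simp
        rw [map_add, hite, MvPolynomial.smul_eq_C_mul, map_mul, map_mul, hX, hC, hC, hite2]
        generalize (if b.1.1 = c.1.2 ∧ b.2.1 = c.2.2 then (1 : ℝ) else 0) = e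
        rw [mul_sub, mul_sub, mul_sub, ← map_mul, ← map_mul, ← map_mul, sub_add_eq_add_sub,
          add_sub_assoc, ← map_sub]
        -- The constant that centring subtracts in the link term is the one that the pair term adds.
        have h0 : 1 / (d : ℝ) ^ 2 * e - 1 / √(s : ℝ) * (1 / (d : ℝ) *
            (1 / (d * √(s : ℝ)) * (√(s : ℝ) ^ 2 * e))) = 0 := by
          field_simp; ring
        rw [h0, map_zero, add_zero, ← mul_assoc, ← mul_assoc, ← map_mul, ← map_mul,
          Finset.mul_sum, Finset.mul_sum]
        refine Finset.sum_congr rfl fun t _ => ?_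
        rw [mul_left_comm _ (MvPolynomial.C (1 / (d * √(s : ℝ)))), ← mul_assoc, ← map_mul,
          mul_comm (MvPolynomial.X _)]
        congr 2
        field_simp
      · have h2 : ¬ (b.1 = c.1.swap ∧ b.2 = c.2.swap) := by
          rintro ⟨h1, h2⟩
          exact h ⟨by rw [h1]; rfl, by rw [h2]; rfl⟩
        simp [h, h2]
    have hX : entrySubst d s (MvPolynomial.X b) = entryPoly d s b := by simp [entrySubst]
    have hl : entrySubst d s ((1 / √(s : ℝ)) • linkDeriv d c (p * MvPolynomial.X b)
        + pairDeriv d c (p * MvPolynomial.X b)) =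
        entrySubst d s p * entrySubst d s ((1 / √(s : ℝ)) • linkDeriv d c (MvPolynomial.X b)
          + pairDeriv d c (MvPolynomial.X b)) + entryPoly d s b *
        entrySubst d s ((1 / √(s : ℝ)) • linkDeriv d c p + pairDeriv d c p) := by
      simp only [Derivation.leibniz, smul_eq_mul, map_add, map_mul, smul_add, hX,
        MvPolynomial.smul_eq_C_mul]
      ring
    rw [hl, ← key, ← hp, map_mul, hX]
    simp only [Derivation.leibniz, smul_eq_mul, Finset.mul_sum]
    rw [← Finset.sum_add_distrib]
    refine Finset.sum_congr rfl fun t _ => ?_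
    ring

variable {Ω : Type*} [MeasurableSpace Ω] {P : Measure Ω} [IsProbabilityMeasure P]

/-- The expectation of a polynomial in the entries of `Q`. -/
def entryExpectation {ζ : (Fin d × Fin d) × Fin s → Ω → ℂ}
    (hl : ∀ v, HasLaw (ζ v) stdComplexGaussian P) : MvPolynomial (EntryIdx d) ℝ →ₗ[ℝ] ℝ :=
  gaussianExpectation hl ∘ₗ (entrySubst d s).toLinearMap

theorem isLoopFunctional_entryExpectation (hd : 0 < d) (hs : 0 < s)
    {ζ : (Fin d × Fin d) × Fin s → Ω → ℂ}
    (hl : ∀ v, HasLaw (ζ v) stdComplexGaussian P) (hi : iIndepFun ζ P) :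
    IsLoopFunctional (linkDeriv d) (pairDeriv d) (1 / √(s : ℝ)) (entryExpectation hl) where
  map_one := by simp [entryExpectation, gaussianExpectation_one]
  loop c f := by
    have h1 : entryExpectation hl (MvPolynomial.X c * f) = gaussianExpectation hl
        (MvPolynomial.C (1 / (d * √(s : ℝ))) *
      ∑ t : Fin s, MvPolynomial.X (((c.1.2, c.2.2), t), true) *
        MvPolynomial.pderiv (((c.1.1, c.2.1), t), true) (entrySubst d s f)) := by
      have hX : entrySubst d s (MvPolynomial.X c) = entryPoly d s c := by simp [entrySubst]
      simp only [entryExpectation, LinearMap.comp_apply, AlgHom.toLinearMap_apply, map_mul, hX]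
      rw [entryPoly, mul_assoc, ← MvPolynomial.smul_eq_C_mul, ← MvPolynomial.smul_eq_C_mul,
        map_smul, map_smul, sub_mul, map_sub, Finset.sum_mul, map_sum, map_sum]
      simp only [mul_assoc, gaussianExpectation_X_mul hl hi, Derivation.leibniz, smul_eq_mul,
        MvPolynomial.pderiv_X, map_add, Finset.sum_add_distrib]
      rw [add_sub_assoc]
      congr 1
      -- What is left is the contraction of the two factors of the entry `c` with each other. Summed
      -- over `t` it gives `s` times `f` when the two index pairs agree, which is the constant
      -- subtracted in `entryPoly`.
      rw [add_eq_left, sub_eq_zero, ← map_sum]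
      congr 1
      rw [← Finset.mul_sum, mul_comm]
      congr 1
      by_cases h : c.1.1 = c.1.2 ∧ c.2.1 = c.2.2
      · simp [h.1, h.2]
      · have : ¬ (c.1.2 = c.1.1 ∧ c.2.2 = c.2.1) := fun h' => h ⟨h'.1.symm, h'.2.symm⟩
        simp [h, this]
    rw [h1, sum_mul_pderiv_entrySubst hd hs]
    simp [entryExpectation]

end LoopEquations

/-! ### Loop equations for normalized traces -/

section TraceRecursion

/-- The ways of merging a trace of degree `p` with one of the traces of degrees `L`, weighted by
the degree of the latter. -/
def mergings (p : ℕ) : List ℕ → List (ℕ × List ℕ)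
  | [] => []
  | q :: L => (q, (p + q) :: L) :: (mergings p L).map fun aL => (aL.1, q :: aL.2)

theorem sum_of_mem_mergings {p : ℕ} {L : List ℕ} {aL : ℕ × List ℕ} (h : aL ∈ mergings p L) :
    aL.2.sum = p + L.sum := by
  induction L generalizing aL with
  | nil => simp [mergings] at h
  | cons q L ih =>
    rw [mergings, List.mem_cons, List.mem_map] at h
    rcases h with rfl | ⟨aL', h', rfl⟩
    · simp [add_assoc]
    · simp [ih h']; omega

variable {n 𝒜 : Type*} [Fintype n] [CommRing 𝒜]

theorem sum_mul_eq_trace (A B : Matrix n n 𝒜) :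
    ∑ a, ∑ b, A b a * B a b = (A * B).trace := by
  rw [Finset.sum_comm]
  simp [Matrix.trace, Matrix.mul_apply]

section

variable [DecidableEq n]

theorem trace_mul_pow_mul_pow (x x' : Matrix n n 𝒜) (p q : ℕ) : ((x' * (x * x') ^ p) * ((x * x') ^ q * x)).trace =
    ((x * x') ^ (p + q + 1)).trace := by
  rw [← mul_assoc, Matrix.trace_mul_comm]
  congr 1
  rw [mul_assoc x', ← pow_add, ← mul_assoc, pow_succ']

theorem mul_single_mul_apply (A B : Matrix n n 𝒜) (u v i j : n) (k : 𝒜) :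
    (A * Matrix.single u v k * B) i j = A i u * k * B v j := by
  rw [Matrix.mul_apply, Finset.sum_eq_single v]
  · rw [Matrix.mul_single_apply_same]
  · intro w _ hw
    rw [Matrix.mul_single_apply_of_ne _ _ _ _ _ hw, zero_mul]
  · simp

end

variable [Algebra ℝ 𝒜]

theorem map_derivation_mul (D : Derivation ℝ 𝒜 𝒜) (A B : Matrix n n 𝒜) :
    (A * B).map D = A.map D * B + A * B.map D := by
  ext i j
  simp only [Matrix.map_apply, Matrix.mul_apply, map_sum, Derivation.leibniz, smul_eq_mul,
    Matrix.add_apply, ← Finset.sum_add_distrib]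
  exact Finset.sum_congr rfl fun k _ => by ring

variable [DecidableEq n]

theorem map_derivation_pow (D : Derivation ℝ 𝒜 𝒜) (A : Matrix n n 𝒜) (p : ℕ) :
    (A ^ p).map D = ∑ ij ∈ Finset.range p, A ^ ij * A.map D * A ^ (p - 1 - ij) := by
  induction p with
  | zero =>
    ext i j
    rw [pow_zero, Matrix.map_apply, Matrix.one_apply]
    split_ifs <;> simp
  | succ p ih =>
    rw [pow_succ, map_derivation_mul, ih, Finset.sum_range_succ, Finset.sum_mul]
    congr 1
    · refine Finset.sum_congr rfl fun i hi => ?_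
      rw [mul_assoc, ← pow_succ]
      congr 2
      have := Finset.mem_range.1 hi
      omega
    · simp

theorem derivation_trace_pow (D : Derivation ℝ 𝒜 𝒜) (A : Matrix n n 𝒜) (p : ℕ) :
    D (A ^ p).trace = p * (A ^ (p - 1) * A.map D).trace := by
  have h : D (A ^ p).trace = ((A ^ p).map D).trace := by
    simp [Matrix.trace, map_sum]
  rw [h, map_derivation_pow, Matrix.trace_sum, Finset.sum_congr rfl
    (g := fun _ => (A ^ (p - 1) * A.map D).trace)]
  · simp
  · intro i hi
    rw [Matrix.trace_mul_comm, ← mul_assoc, ← pow_add]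
    have := Finset.mem_range.1 hi
    congr 3
    omega

/-- Matrices `x`, `x'` over an algebra with derivations `D a b` for which the derivatives of their
entries are those in the loop equations of a Ginibre matrix: a complex one for `ε = 0`, and one
with a real structure given by `F` for `ε = 1`. -/
structure IsGinibreDeriv (F : n ≃ n) (ε c : ℝ) (x x' : Matrix n n 𝒜)
    (D : n → n → Derivation ℝ 𝒜 𝒜) : Prop where
  map_left : ∀ a b, x.map (D a b) = Matrix.single (F a) (F b) (algebraMap ℝ 𝒜 (ε * c))
  map_right : ∀ a b, x'.map (D a b) = Matrix.single b a (algebraMap ℝ 𝒜 c)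
  involutive : ∀ a, F (F a) = a
  symm : ε = 0 ∨ x' = xᵀ.submatrix F F
  card : c * Fintype.card n = 1

/-- The normalized traces of the powers of `x * x'`. -/
def traceMoment (c : ℝ) (x x' : Matrix n n 𝒜) (p : ℕ) : 𝒜 :=
  algebraMap ℝ 𝒜 c * ((x * x') ^ p).trace

/-- Isolates the first factor `x` of the cyclic word, the one to which the loop equation is applied.
-/
theorem traceMoment_succ_mul (c : ℝ) (x x' : Matrix n n 𝒜) (p : ℕ) (f : 𝒜) :
    traceMoment c x x' (p + 1) * f =
      algebraMap ℝ 𝒜 c * ∑ a, ∑ b, x a b * ((x' * (x * x') ^ p) b a * f) := by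
  have e : ((x * x') ^ (p + 1)).trace = ∑ a, ∑ b, x a b * (x' * (x * x') ^ p) b a := by
    rw [pow_succ', mul_assoc]
    simp [Matrix.trace, Matrix.mul_apply]
  rw [traceMoment, e, mul_assoc, Finset.sum_mul]
  congr 1
  refine Finset.sum_congr rfl fun a _ => ?_
  rw [Finset.sum_mul]
  exact Finset.sum_congr rfl fun b _ => mul_assoc _ _ _

namespace IsGinibreDeriv

variable {F : n ≃ n} {ε c : ℝ} {x x' : Matrix n n 𝒜} {D : n → n → Derivation ℝ 𝒜 𝒜}

theorem traceMoment_zero (h : IsGinibreDeriv F ε c x x' D) : traceMoment c x x' 0 = 1 := by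
  rw [traceMoment, pow_zero, Matrix.trace_one, ← map_natCast (algebraMap ℝ 𝒜), ← map_mul, h.card,
    map_one]

theorem map_mul (h : IsGinibreDeriv F ε c x x' D) (a b : n) :
    (x * x').map (D a b) = Matrix.single (F a) (F b) (algebraMap ℝ 𝒜 (ε * c)) * x'
      + x * Matrix.single b a (algebraMap ℝ 𝒜 c) := by
  rw [map_derivation_mul, h.map_left, h.map_right]

theorem pow_dagger (h : IsGinibreDeriv F ε c x x' D) (hx : x' = xᵀ.submatrix F F) (p : ℕ) :
    (((x * x') ^ p)ᵀ).submatrix F F = (x * x') ^ p := by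
  have h1 : x'ᵀ.submatrix F F = x := by
    rw [hx]; ext i j; simp [h.involutive]
  have hW : ((x * x')ᵀ).submatrix F F = x * x' := by
    rw [Matrix.transpose_mul, ← Matrix.submatrix_mul_equiv _ _ F F F, h1, ← hx]
  induction p with
  | zero => ext i j; simp [Matrix.one_apply]
  | succ p ih =>
    conv_lhs => rw [pow_succ, Matrix.transpose_mul, ← Matrix.submatrix_mul_equiv _ _ F F F]
    rw [ih, hW, ← pow_succ']

/-- The symmetry of `x' * (x * x') ^ p` under the real structure. -/
theorem mul_pow_apply (h : IsGinibreDeriv F ε c x x' D) (p : ℕ) (a b : n) :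
    algebraMap ℝ 𝒜 ε * (x' * (x * x') ^ p) (F b) a =
      algebraMap ℝ 𝒜 ε * ((x * x') ^ p * x) (F a) b := by
  rcases h.symm with rfl | hx
  · simp
  · congr 1
    have h1 : x'ᵀ.submatrix F F = x := by
      rw [hx]; ext i j; simp [h.involutive]
    have h2 : ((x' * (x * x') ^ p)ᵀ).submatrix F F = (x * x') ^ p * x := by
      rw [Matrix.transpose_mul, ← Matrix.submatrix_mul_equiv _ _ F F F, h1, h.pow_dagger hx]
    rw [← h2, Matrix.submatrix_apply, Matrix.transpose_apply, h.involutive]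

/-- A derivative hitting a factor `x'` cuts the cyclic word into two traces; the leading `x'`
accounts for the term i = 0. A derivative hitting a factor `x` acts through the real structure: it
reverses part of the word and leaves a single trace, with weight `ε * c` for each of the `p`
factors. -/
theorem sum_derivation_mul_pow (h : IsGinibreDeriv F ε c x x' D) (p : ℕ) :
    algebraMap ℝ 𝒜 c * ∑ a, ∑ b, D a b ((x' * (x * x') ^ p) b a) =
      ∑ i ∈ Finset.range (p + 1), traceMoment c x x' i * traceMoment c x x' (p - i)
        + algebraMap ℝ 𝒜 (ε * c * p) * traceMoment c x x' p := by
  set W := x * x' with hW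
  have hterm : ∀ a b, D a b ((x' * W ^ p) b a) = algebraMap ℝ 𝒜 c * (W ^ p) a a +
      ∑ i ∈ Finset.range p, (algebraMap ℝ 𝒜 c * (algebraMap ℝ 𝒜 ε *
        ((x' * W ^ i) b (F a) * (W ^ (p - 1 - i) * x) (F a) b)) + algebraMap ℝ 𝒜 c *
          ((x' * W ^ i * x) b b * (W ^ (p - 1 - i)) a a)) := by
    intro a b
    have e1 : D a b ((x' * W ^ p) b a) = ((x' * W ^ p).map (D a b)) b a := rfl
    have e2 := mul_single_mul_apply 1 (W ^ p) b a b a (algebraMap ℝ 𝒜 c)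
    rw [one_mul] at e2
    rw [e1, map_derivation_mul, h.map_right, map_derivation_pow, h.map_mul, Matrix.add_apply, e2,
      Matrix.one_apply_eq, one_mul, Finset.mul_sum, Matrix.sum_apply]
    congr 1
    refine Finset.sum_congr rfl fun i _ => ?_
    have e3 : x' * (W ^ i * (Matrix.single (F a) (F b) (algebraMap ℝ 𝒜 (ε * c)) * x'
        + x * Matrix.single b a (algebraMap ℝ 𝒜 c)) * W ^ (p - 1 - i)) =
        (x' * W ^ i) * Matrix.single (F a) (F b) (algebraMap ℝ 𝒜 (ε * c)) * (x' * W ^ (p - 1 - i))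
        + (x' * W ^ i * x) * Matrix.single b a (algebraMap ℝ 𝒜 c) * W ^ (p - 1 - i) := by
      noncomm_ring
    rw [e3, Matrix.add_apply, mul_single_mul_apply, mul_single_mul_apply, RingHom.map_mul]
    have e4 := h.mul_pow_apply (p - 1 - i) a b
    rw [← hW] at e4
    linear_combination (algebraMap ℝ 𝒜 c * (x' * W ^ i) b (F a)) * e4
  have hsum : ∀ i ∈ Finset.range p, ∑ a, ∑ b, (algebraMap ℝ 𝒜 c * (algebraMap ℝ 𝒜 ε *
        ((x' * W ^ i) b (F a) * (W ^ (p - 1 - i) * x) (F a) b)) + algebraMap ℝ 𝒜 c *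
          ((x' * W ^ i * x) b b * (W ^ (p - 1 - i)) a a)) =
      algebraMap ℝ 𝒜 c * (algebraMap ℝ 𝒜 ε * (W ^ p).trace) +
      algebraMap ℝ 𝒜 c * ((W ^ (i + 1)).trace * (W ^ (p - 1 - i)).trace) := by
    intro i hi
    have hi' := Finset.mem_range.1 hi
    simp only [Finset.sum_add_distrib, ← Finset.mul_sum]
    congr 3
    · rw [Equiv.sum_comp F (fun a => ∑ b, (x' * W ^ i) b a * (W ^ (p - 1 - i) * x) a b),
        sum_mul_eq_trace, hW, trace_mul_pow_mul_pow]
      congr 2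
      omega
    · have e := trace_mul_pow_mul_pow x x' i 0
      rw [pow_zero, one_mul, add_zero, ← hW] at e
      rw [Finset.sum_comm]
      simp only [← Finset.mul_sum, ← Finset.sum_mul]
      exact congrArg (· * (W ^ (p - 1 - i)).trace) e
  have hcard : algebraMap ℝ 𝒜 c * (Fintype.card n : 𝒜) = 1 := by
    rw [← map_natCast (algebraMap ℝ 𝒜), ← RingHom.map_mul, h.card, map_one]
  have e5 : ∑ a : n, ∑ _b : n, algebraMap ℝ 𝒜 c * (W ^ p) a a = (W ^ p).trace := by
    simp only [Finset.sum_const, Finset.card_univ, nsmul_eq_mul, ← Finset.mul_sum]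
    rw [mul_left_comm, ← mul_assoc, hcard, one_mul, Matrix.trace]
    rfl
  have e6 : ∀ f : ℕ → n → n → 𝒜, ∑ a, ∑ b, ∑ i ∈ Finset.range p, f i a b =
      ∑ i ∈ Finset.range p, ∑ a, ∑ b, f i a b := by
    intro f
    rw [Finset.sum_comm (s := Finset.range p)]
    exact Finset.sum_congr rfl fun a _ => Finset.sum_comm
  have e7 : ∑ a, ∑ b, D a b ((x' * W ^ p) b a) = (W ^ p).trace +
      ∑ i ∈ Finset.range p, (algebraMap ℝ 𝒜 c * (algebraMap ℝ 𝒜 ε * (W ^ p).trace) +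
      algebraMap ℝ 𝒜 c * ((W ^ (i + 1)).trace * (W ^ (p - 1 - i)).trace)) := by
    rw [← Finset.sum_congr rfl hsum, ← e6, ← e5, ← Finset.sum_add_distrib]
    refine Finset.sum_congr rfl fun a _ => ?_
    rw [← Finset.sum_add_distrib]
    exact Finset.sum_congr rfl fun b _ => hterm a b
  rw [e7, Finset.sum_range_succ', Finset.sum_add_distrib, Finset.sum_const, Finset.card_range,
    h.traceMoment_zero, tsub_zero, one_mul]
  have e8 : ∀ i ∈ Finset.range p, traceMoment c x x' (i + 1) * traceMoment c x x' (p - (i + 1)) =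
      algebraMap ℝ 𝒜 c * (algebraMap ℝ 𝒜 c *
        ((W ^ (i + 1)).trace * (W ^ (p - 1 - i)).trace)) := by
    intro i _
    have : p - (i + 1) = p - 1 - i := by omega
    rw [traceMoment, traceMoment, ← hW, this]
    ring
  rw [Finset.sum_congr rfl e8, traceMoment, ← hW, nsmul_eq_mul]
  simp only [RingHom.map_mul, map_natCast, ← Finset.mul_sum]
  ring

/-- Hitting a second trace merges it with the first. It offers `q` factors `x'` and, through the
real structure, `q` factors `x` with weight `ε`. One power of `c` comes from the derivative and one
from the normalization of the absorbed trace. -/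
theorem sum_mul_derivation_traceMoment (h : IsGinibreDeriv F ε c x x' D) (p q : ℕ) :
    algebraMap ℝ 𝒜 c * ∑ a, ∑ b, (x' * (x * x') ^ p) b a * D a b (traceMoment c x x' q) =
      algebraMap ℝ 𝒜 ((1 + ε) * c ^ 2 * q) * traceMoment c x x' (p + q) := by
  rcases Nat.eq_zero_or_pos q with rfl | hq
  · simp [h.traceMoment_zero]
  have hD : ∀ a b, D a b (traceMoment c x x' q) =
      algebraMap ℝ 𝒜 ((1 + ε) * c ^ 2 * q) * ((x * x') ^ (q - 1) * x) a b := by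
    intro a b
    have e1 : (x * x') ^ (q - 1) * (x * x').map (D a b) =
        (x * x') ^ (q - 1) * Matrix.single (F a) (F b) (algebraMap ℝ 𝒜 (ε * c)) * x' +
          ((x * x') ^ (q - 1) * x) * Matrix.single b a (algebraMap ℝ 𝒜 c) := by
      rw [h.map_mul]; noncomm_ring
    have e2 : ((x * x') ^ (q - 1) * Matrix.single (F a) (F b) (algebraMap ℝ 𝒜 (ε * c)) * x').trace
        = algebraMap ℝ 𝒜 (ε * c) * (x' * (x * x') ^ (q - 1)) (F b) (F a) := by
      rw [Matrix.trace_mul_comm, ← mul_assoc, Matrix.trace_mul_single, op_smul_eq_mul, mul_comm]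
    have e3 := h.mul_pow_apply (q - 1) (F a) b
    rw [h.involutive] at e3
    rw [traceMoment, Derivation.leibniz, Derivation.map_algebraMap, smul_zero, add_zero,
      smul_eq_mul, derivation_trace_pow, e1, Matrix.trace_add, e2, Matrix.trace_mul_single,
      op_smul_eq_mul]
    simp only [RingHom.map_mul, RingHom.map_add, RingHom.map_pow, RingHom.map_one, map_natCast]
    linear_combination (algebraMap ℝ 𝒜 c * q * algebraMap ℝ 𝒜 c) * e3
  simp only [hD]
  have e4 : ∑ a, ∑ b, (x' * (x * x') ^ p) b a *
      (algebraMap ℝ 𝒜 ((1 + ε) * c ^ 2 * q) * ((x * x') ^ (q - 1) * x) a b) =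
      algebraMap ℝ 𝒜 ((1 + ε) * c ^ 2 * q) * ((x * x') ^ (p + q)).trace := by
    have := trace_mul_pow_mul_pow x x' p (q - 1)
    rw [show p + (q - 1) + 1 = p + q by omega] at this
    rw [← this, ← sum_mul_eq_trace, Finset.mul_sum]
    refine Finset.sum_congr rfl fun a _ => ?_
    rw [Finset.mul_sum]
    exact Finset.sum_congr rfl fun b _ => by ring
  rw [e4, traceMoment]
  ring

theorem sum_mul_derivation_prod (h : IsGinibreDeriv F ε c x x' D) (p : ℕ) (L : List ℕ) :
    algebraMap ℝ 𝒜 c * ∑ a, ∑ b, (x' * (x * x') ^ p) b a *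
        D a b (L.map (traceMoment c x x')).prod =
      ((mergings p L).map fun aL => algebraMap ℝ 𝒜 ((1 + ε) * c ^ 2 * aL.1) *
        (aL.2.map (traceMoment c x x')).prod).sum := by
  induction L with
  | nil => simp [mergings]
  | cons q L ih =>
    simp only [mergings, List.map_cons, List.sum_cons, List.prod_cons, List.map_map]
    have e1 : (List.map ((fun aL : ℕ × List ℕ => algebraMap ℝ 𝒜 ((1 + ε) * c ^ 2 * aL.1) *
        (aL.2.map (traceMoment c x x')).prod) ∘ fun aL => (aL.1, q :: aL.2)) (mergings p L)).sum =
        traceMoment c x x' q * ((mergings p L).map fun aL =>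
          algebraMap ℝ 𝒜 ((1 + ε) * c ^ 2 * aL.1) * (aL.2.map (traceMoment c x x')).prod).sum := by
      rw [← List.sum_map_mul_left]
      congr 1
      refine List.map_congr_left fun aL _ => ?_
      simp only [Function.comp, List.map_cons, List.prod_cons]
      ring
    rw [e1, ← ih, ← mul_assoc (algebraMap ℝ 𝒜 ((1 + ε) * c ^ 2 * q)),
      ← h.sum_mul_derivation_traceMoment p q]
    simp only [Derivation.leibniz, smul_eq_mul, Finset.mul_sum, Finset.sum_mul,
      ← Finset.sum_add_distrib]
    refine Finset.sum_congr rfl fun a _ => Finset.sum_congr rfl fun b _ => ?_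
    ring

theorem sum_derivation_mul_prod (h : IsGinibreDeriv F ε c x x' D) (p : ℕ) (L : List ℕ) :
    algebraMap ℝ 𝒜 c * ∑ a, ∑ b, D a b ((x' * (x * x') ^ p) b a *
        (L.map (traceMoment c x x')).prod) =
      ∑ i ∈ Finset.range (p + 1), ((i :: (p - i) :: L).map (traceMoment c x x')).prod
        + algebraMap ℝ 𝒜 (ε * c * p) * ((p :: L).map (traceMoment c x x')).prod
        + ((mergings p L).map fun aL => algebraMap ℝ 𝒜 ((1 + ε) * c ^ 2 * aL.1) *
          (aL.2.map (traceMoment c x x')).prod).sum := by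
  rw [← h.sum_mul_derivation_prod]
  have e1 := congrArg (· * (L.map (traceMoment c x x')).prod) (h.sum_derivation_mul_pow p)
  simp only [add_mul, Finset.sum_mul] at e1
  simp only [List.map_cons, List.prod_cons, ← mul_assoc]
  rw [← e1]
  simp only [Derivation.leibniz, smul_eq_mul, Finset.mul_sum, Finset.sum_mul,
    ← Finset.sum_add_distrib]
  refine Finset.sum_congr rfl fun a _ => Finset.sum_congr rfl fun b _ => ?_
  ring

end IsGinibreDeriv

end TraceRecursion

/-! ### Asymptotics of the trace recursion -/

section Recursion

/-- The recursion satisfied by the mixed trace moments of a Ginibre matrix, with remainder. -/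
structure IsTraceRecursion (ε c : ℝ) (m : List ℕ → ℝ) (rem : ℕ → List ℕ → ℝ) : Prop where
  nil : m [] = 1
  zero : ∀ L, m (0 :: L) = m L
  succ : ∀ p L, m ((p + 1) :: L) = ∑ i ∈ Finset.range (p + 1), m (i :: (p - i) :: L)
    + ε * c * p * m (p :: L) + ((mergings p L).map fun aL => (1 + ε) * c ^ 2 * aL.1 * m aL.2).sum
    + rem p L

/-- The sum decreases at every use of the recursion. Heads equal to zero leave it unchanged and are
removed by an inner induction on the list. -/
theorem list_induction_sum {motive : List ℕ → Prop} (nil : motive [])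
    (zero : ∀ L, motive L → motive (0 :: L))
    (succ : ∀ p L, (∀ L', L'.sum < p + 1 + L.sum → motive L') → motive ((p + 1) :: L)) :
    ∀ L, motive L := by
  intro L
  induction hN : L.sum using Nat.strong_induction_on generalizing L with
  | _ N ih =>
    induction L with
    | nil => exact nil
    | cons p L ihL =>
      cases p with
      | zero => exact zero L (ihL (by simpa using hN))
      | succ p =>
        refine succ p L fun L' hL' => ih L'.sum ?_ L' rfl
        simpa [← hN] using hL'

theorem isBigO_list_sum {α κ : Type*} {l : Filter α} (S : List κ) {f : κ → α → ℝ} {g : α → ℝ}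
    (h : ∀ k ∈ S, f k =O[l] g) : (fun a => (S.map fun k => f k a).sum) =O[l] g := by
  induction S with
  | nil => simpa using Asymptotics.isBigO_zero g l
  | cons k S ih =>
    simp only [List.map_cons, List.sum_cons]
    exact (h k (by simp)).add (ih fun k hk => h k (by simp [hk]))

theorem isBigO_one_of_isTraceRecursion {α : Type*} {l : Filter α} {ε : ℝ} {c : α → ℝ}
    {m : α → List ℕ → ℝ} {rem : α → ℕ → List ℕ → ℝ}
    (h : ∀ a, IsTraceRecursion ε (c a) (m a) (rem a)) (hc : c =O[l] fun _ => (1 : ℝ))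
    (hrem : ∀ p L, (fun a => rem a p L) =O[l] fun _ => (1 : ℝ)) (L : List ℕ) :
    (fun a => m a L) =O[l] fun _ => (1 : ℝ) := by
  have hmul : ∀ {f g : α → ℝ}, f =O[l] (fun _ => (1 : ℝ)) → g =O[l] (fun _ => (1 : ℝ)) →
      (fun a => f a * g a) =O[l] fun _ => (1 : ℝ) := fun hf hg => by simpa using hf.mul hg
  induction L using list_induction_sum with
  | nil => simpa [(h _).nil] using Asymptotics.isBigO_refl (fun _ : α => (1 : ℝ)) l
  | zero L ih => simpa [(h _).zero] using ih
  | succ p L ih =>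
    simp only [(h _).succ]
    refine ((Asymptotics.IsBigO.add ?_ ?_).add ?_).add (hrem p L)
    · refine Asymptotics.IsBigO.fun_sum fun i hi => ih _ ?_
      have := Finset.mem_range.1 hi
      simp; omega
    · exact hmul (hmul (hc.const_mul_left ε) (Asymptotics.isBigO_const_const _ one_ne_zero _))
        (ih _ (by simp))
    · refine isBigO_list_sum _ fun aL haL => hmul (hmul ?_ (Asymptotics.isBigO_const_const _
        one_ne_zero _)) (ih _ ?_)
      · exact ((by simpa using hc.pow 2 : (fun a => c a ^ 2) =O[l] fun _ => (1 : ℝ))).const_mul_left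
          (1 + ε)
      · have := sum_of_mem_mergings haL
        omega

/-- Only the splitting terms survive in the limit. They form the Catalan recursion for the head of
the list with the tail as a spectator, so the limits factor. -/
theorem tendsto_of_isTraceRecursion {α : Type*} {l : Filter α} {ε : ℝ} {c : α → ℝ}
    {m : α → List ℕ → ℝ} {rem : α → ℕ → List ℕ → ℝ}
    (h : ∀ᶠ a in l, IsTraceRecursion ε (c a) (m a) (rem a)) (hc : Tendsto c l (𝓝 0))
    (hrem : ∀ p L, Tendsto (fun a => rem a p L) l (𝓝 0)) (L : List ℕ) :
    Tendsto (fun a => m a L) l (𝓝 ((L.map fun p => (catalan p : ℝ)).prod)) := by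
  induction L using list_induction_sum with
  | nil =>
    refine tendsto_const_nhds.congr' (h.mono fun a ha => ?_)
    simp [ha.nil]
  | zero L ih =>
    simp only [List.map_cons, catalan_zero, Nat.cast_one, List.prod_cons, one_mul]
    exact ih.congr' (h.mono fun a ha => (ha.zero L).symm)
  | succ p L ih =>
    -- Products of Catalan numbers solve the recursion with `c = 0` and no remainder.
    have e : (((p + 1) :: L).map fun p => (catalan p : ℝ)).prod =
        ∑ i ∈ Finset.range (p + 1), ((i :: (p - i) :: L).map fun p => (catalan p : ℝ)).prod
          + ε * 0 * p * ((p :: L).map fun p => (catalan p : ℝ)).prod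
          + ((mergings p L).map fun aL => (1 + ε) * 0 ^ 2 * aL.1 *
            (aL.2.map fun p => (catalan p : ℝ)).prod).sum + 0 := by
      simp only [List.map_cons, List.prod_cons, catalan_succ, ← mul_assoc]
      rw [← Finset.sum_mul, ← Finset.sum_range (fun i => catalan i * catalan (p - i))]
      simp
    rw [e]
    refine Tendsto.congr' (h.mono fun a ha => (ha.succ p L).symm) ?_
    refine ((Tendsto.add ?_ ?_).add ?_).add (hrem p L)
    · refine tendsto_finsetSum _ fun i hi => ih _ ?_
      have := Finset.mem_range.1 hi
      simp; omega
    · exact ((hc.const_mul ε).mul_const _).mul (ih _ (by simp))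
    · refine tendsto_list_sum _ fun aL haL => (((hc.pow 2).const_mul _).mul_const _).mul (ih _ ?_)
      have := sum_of_mem_mergings haL
      omega

end Recursion

/-! ### From loop equations to the recursion with remainder -/

section FunctionalRecursion

variable {n 𝒜 : Type*} [Fintype n] [DecidableEq n] [CommRing 𝒜] [Algebra ℝ 𝒜]
  {F : n ≃ n} {ε c : ℝ} {x x' : Matrix n n 𝒜} {D : n → n → Derivation ℝ 𝒜 𝒜}

/-- The defect in the loop equation for a product of trace moments. -/
def loopRemainder (c : ℝ) (x x' : Matrix n n 𝒜) (D : n → n → Derivation ℝ 𝒜 𝒜) (E : 𝒜 →ₗ[ℝ] ℝ)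
    (p : ℕ) (L : List ℕ) : ℝ :=
  c * ∑ a, ∑ b, (E (x a b * ((x' * (x * x') ^ p) b a * (L.map (traceMoment c x x')).prod)) -
    E (D a b ((x' * (x * x') ^ p) b a * (L.map (traceMoment c x x')).prod)))

/-- No loop equation is assumed of `E`: whatever fails is collected in `loopRemainder`, which is
estimated separately. -/
theorem IsGinibreDeriv.isTraceRecursion (h : IsGinibreDeriv F ε c x x' D) {E : 𝒜 →ₗ[ℝ] ℝ}
    (hE : E 1 = 1) : IsTraceRecursion ε c (fun L => E (L.map (traceMoment c x x')).prod)
      (loopRemainder c x x' D E) where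
  nil := by simp [hE]
  zero L := by simp [h.traceMoment_zero]
  succ p L := by
    have hlist : ∀ S : List (ℕ × List ℕ),
        E (S.map fun aL => algebraMap ℝ 𝒜 ((1 + ε) * c ^ 2 * aL.1) *
          (aL.2.map (traceMoment c x x')).prod).sum =
        (S.map fun aL => (1 + ε) * c ^ 2 * aL.1 * E (aL.2.map (traceMoment c x x')).prod).sum := by
      intro S
      induction S with
      | nil => simp
      | cons aL S ih =>
        simp only [List.map_cons, List.sum_cons]
        rw [map_add, ih, ← Algebra.smul_def, map_smul, smul_eq_mul]
    have h1 := congrArg E (h.sum_derivation_mul_prod p L)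
    rw [map_add, map_add, hlist, ← Algebra.smul_def, ← Algebra.smul_def, map_smul, map_smul,
      map_sum, map_sum] at h1
    have h2 := congrArg E (traceMoment_succ_mul c x x' p (L.map (traceMoment c x x')).prod)
    rw [← Algebra.smul_def, map_smul, map_sum] at h2
    simp only [smul_eq_mul, map_sum] at h1 h2
    rw [List.map_cons, List.prod_cons, h2, ← h1, loopRemainder]
    simp only [Finset.sum_sub_distrib]
    ring

end FunctionalRecursion

/-! ### Uniform trace bounds for complex Ginibre matrices -/

section Ginibre

variable {d : ℕ}

/-- A normalized complex Ginibre matrix, with entries in the polynomials in its coefficients. -/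
def ginibrePoly (d : ℕ) :
    Matrix (Fin d) (Fin d) (MvPolynomial (((Fin d × Fin d) × Fin 1) × Bool) ℝ) :=
  Matrix.of fun i j => MvPolynomial.C (1 / √(d : ℝ)) * MvPolynomial.X (((i, j), 0), false)

/-- The adjoint of `ginibrePoly`. -/
def ginibreAdjPoly (d : ℕ) :
    Matrix (Fin d) (Fin d) (MvPolynomial (((Fin d × Fin d) × Fin 1) × Bool) ℝ) :=
  Matrix.of fun i j => MvPolynomial.C (1 / √(d : ℝ)) * MvPolynomial.X (((j, i), 0), true)

theorem isGinibreDeriv_ginibrePoly (hd : 0 < d) :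
    IsGinibreDeriv (Equiv.refl _) 0 (1 / (d : ℝ)) (ginibrePoly d) (ginibreAdjPoly d)
      (fun a b => (1 / √(d : ℝ)) • MvPolynomial.pderiv (((a, b), 0), true)) where
  map_left a b := by
    ext1 i j
    simp [ginibrePoly, Derivation.leibniz]
  map_right a b := by
    ext1 i j
    have h : (1 / √(d : ℝ)) * (1 / √(d : ℝ)) = 1 / (d : ℝ) := by
      rw [div_mul_div_comm, Real.mul_self_sqrt (by positivity), one_mul]
    rw [Matrix.single_apply, ← h]
    by_cases hc : b = i ∧ a = j
    · obtain ⟨rfl, rfl⟩ := hc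
      simp [ginibreAdjPoly, Derivation.leibniz, MvPolynomial.smul_eq_C_mul,
        MvPolynomial.algebraMap_eq]
    · have : ¬ (j = a ∧ i = b) := fun h => hc ⟨h.2.symm, h.1.symm⟩
      simp [ginibreAdjPoly, Derivation.leibniz, hc, this]
  involutive _ := rfl
  symm := .inl rfl
  card := by
    have : (d : ℝ) ≠ 0 := by positivity
    simp [this]

variable {Ω : Type*} [MeasurableSpace Ω] {P : Measure Ω} [IsProbabilityMeasure P]

theorem loopRemainder_ginibrePoly {ζ : (Fin d × Fin d) × Fin 1 → Ω → ℂ}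
    (hl : ∀ v, HasLaw (ζ v) stdComplexGaussian P) (hi : iIndepFun ζ P) (p : ℕ) (L : List ℕ) :
    loopRemainder (1 / (d : ℝ)) (ginibrePoly d) (ginibreAdjPoly d)
      (fun a b => (1 / √(d : ℝ)) • MvPolynomial.pderiv (((a, b), 0), true))
      (gaussianExpectation hl) p L = 0 := by
  unfold loopRemainder
  refine mul_eq_zero_of_right _ (Finset.sum_eq_zero fun a _ => Finset.sum_eq_zero fun b _ => ?_)
  generalize (ginibreAdjPoly d * (ginibrePoly d * ginibreAdjPoly d) ^ p) b a *
    (L.map (traceMoment (1 / (d : ℝ)) (ginibrePoly d) (ginibreAdjPoly d))).prod = f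
  rw [ginibrePoly, Matrix.of_apply, mul_assoc, ← MvPolynomial.smul_eq_C_mul, map_smul,
    gaussianExpectation_X_mul hl hi, Derivation.smul_apply, map_smul, sub_self]

theorem exists_bound_ginibrePoly {Ω : ℕ → Type*} [∀ d, MeasurableSpace (Ω d)]
    {P : ∀ d, Measure (Ω d)} [∀ d, IsProbabilityMeasure (P d)]
    {ζ : ∀ d, (Fin d × Fin d) × Fin 1 → Ω d → ℂ}
    (hl : ∀ d v, HasLaw (ζ d v) stdComplexGaussian (P d)) (hi : ∀ d, iIndepFun (ζ d) (P d))
    (L : List ℕ) : ∃ C : ℝ, ∀ d, 0 < d → |gaussianExpectation (hl d)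
      (L.map (traceMoment (1 / (d : ℝ)) (ginibrePoly d) (ginibreAdjPoly d))).prod| ≤ C := by
  -- Along the filter `⊤` a bound O(1) is uniform over all indices; the shift to `a + 1` leaves out
  -- dimension zero.
  have h := isBigO_one_of_isTraceRecursion (l := ⊤) (ε := 0) (c := fun a : ℕ => 1 / ((a + 1 : ℕ) : ℝ))
    (fun a => (isGinibreDeriv_ginibrePoly (Nat.succ_pos a)).isTraceRecursion
      (gaussianExpectation_one (hl (a + 1)))) ?_ ?_ L
  · rw [Asymptotics.isBigO_one_iff, Filter.IsBoundedUnder, Filter.IsBounded] at h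
    obtain ⟨C, hC⟩ := h
    simp only [eventually_map, eventually_top] at hC
    refine ⟨C, fun d hd => ?_⟩
    obtain ⟨a, rfl⟩ := Nat.exists_eq_add_of_lt hd
    simpa using hC (0 + a)
  · refine Asymptotics.IsBigO.of_bound 1 (Eventually.of_forall fun a => ?_)
    rw [Real.norm_of_nonneg (by positivity), norm_one, mul_one]
    exact div_le_one_of_le₀ (by push_cast; linarith [(Nat.cast_nonneg a : (0 : ℝ) ≤ a)])
      (by positivity)
  · intro p L
    simp only [loopRemainder_ginibrePoly _ (hi _)]
    exact Asymptotics.isBigO_zero _ _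

end Ginibre

/-! ### Comparison with s = 1 and limits of the mixed trace moments -/

section EntryMatrix

variable {d s : ℕ}

/-- The matrix of variables standing for `Q`. -/
def entryMatrix (d : ℕ) : Matrix (Fin d × Fin d) (Fin d × Fin d) (MvPolynomial (EntryIdx d) ℝ) :=
  Matrix.of fun a b => MvPolynomial.X (a, b)

/-- The matrix of variables standing for the adjoint of `Q`. -/
def entryAdjMatrix (d : ℕ) : Matrix (Fin d × Fin d) (Fin d × Fin d) (MvPolynomial (EntryIdx d) ℝ) :=
  (entryMatrix d)ᵀ.submatrix (Equiv.prodComm _ _) (Equiv.prodComm _ _)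

/-- The polynomial giving `(1/d²) Tr[(Q Q*)^p]`. -/
def tracePoly (d p : ℕ) : MvPolynomial (EntryIdx d) ℝ :=
  traceMoment (1 / (d : ℝ) ^ 2) (entryMatrix d) (entryAdjMatrix d) p

theorem isGinibreDeriv_entryMatrix (hd : 0 < d) :
    IsGinibreDeriv (Equiv.prodComm _ _) 1 (1 / (d : ℝ) ^ 2) (entryMatrix d) (entryAdjMatrix d)
      (fun a b => pairDeriv d (a, b)) where
  map_left a b := by
    ext1 u v
    simp only [entryMatrix, Matrix.map_apply, Matrix.of_apply, pairDeriv,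
      MvPolynomial.mkDerivation_X, Matrix.single_apply, MvPolynomial.algebraMap_eq, one_mul,
      Equiv.prodComm_apply]
    simp only [eq_comm]
  map_right a b := by
    ext1 u v
    simp only [entryAdjMatrix, entryMatrix, Matrix.map_apply, Matrix.of_apply, pairDeriv,
      MvPolynomial.mkDerivation_X, Matrix.single_apply, MvPolynomial.algebraMap_eq,
      Equiv.prodComm_apply, Matrix.submatrix_apply, Matrix.transpose_apply, Prod.swap_inj]
    congr 1
    simp only [eq_iff_iff]
    constructor <;> rintro ⟨rfl, rfl⟩ <;> exact ⟨rfl, rfl⟩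
  involutive a := by simp
  symm := .inr rfl
  card := by
    have : (d : ℝ) ≠ 0 := by positivity
    simp only [Fintype.card_prod, Fintype.card_fin]
    push_cast
    field_simp

theorem isPos_entryMatrix (u v : Fin d × Fin d) : IsPos (entryMatrix d u v) := .var _

theorem isPos_entryAdjMatrix (u v : Fin d × Fin d) : IsPos (entryAdjMatrix d u v) := .var _

theorem isPos_tracePoly (d p : ℕ) : IsPos (tracePoly d p) := by
  refine (IsPos.const (by positivity)).mul (IsPos.sum _ fun a _ => ?_)
  exact IsPos.matrix_pow (IsPos.matrix_mul isPos_entryMatrix isPos_entryAdjMatrix) p a a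

theorem isPos_prod_tracePoly (d : ℕ) (L : List ℕ) : IsPos (L.map (tracePoly d)).prod := by
  refine IsPos.list_prod fun f hf => ?_
  obtain ⟨p, _, rfl⟩ := List.mem_map.1 hf
  exact isPos_tracePoly d p

/-- The entries of the mean of `(G ⊗ conj G) / d` for a Ginibre matrix `G`. -/
def entryMean (d : ℕ) (c : EntryIdx d) : ℝ :=
  if c.1.1 = c.1.2 ∧ c.2.1 = c.2.2 then 1 / (d : ℝ) else 0

/-- For s = 1 the Wishart matrix has rank one and its realignment is a tensor product; the shift
undoes the centring. -/
theorem entrySubst_shift_X (c : EntryIdx d) :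
    entrySubst d 1 (shift (entryMean d) (MvPolynomial.X c)) =
      ginibrePoly d c.1.1 c.2.1 * ginibreAdjPoly d c.2.2 c.1.2 := by
  have h : (1 / √(d : ℝ)) * (1 / √(d : ℝ)) = 1 / (d : ℝ) := by
    rw [div_mul_div_comm, Real.mul_self_sqrt (by positivity), one_mul]
  have e : entrySubst d 1 (shift (entryMean d) (MvPolynomial.X c)) =
      entryPoly d 1 c + MvPolynomial.C (entryMean d c) := by
    simp [shift, entrySubst]
  rw [e, entryPoly, entryMean, ginibrePoly, ginibreAdjPoly, Matrix.of_apply, Matrix.of_apply,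
    mul_mul_mul_comm, ← map_mul, h]
  simp only [Nat.cast_one, Real.sqrt_one, mul_one, Finset.univ_unique, Finset.sum_singleton,
    Fin.default_eq_zero, mul_sub, ← map_mul]
  split_ifs <;> simp

open scoped Kronecker in
-- The shifted matrix is a Kronecker product, so its traces factor. The second factor is the
-- transpose of the first and has the same trace.
theorem entrySubst_shift_tracePoly (hd : 0 < d) (p : ℕ) :
    entrySubst d 1 (shift (entryMean d) (tracePoly d p)) =
      traceMoment (1 / (d : ℝ)) (ginibrePoly d) (ginibreAdjPoly d) p *
        traceMoment (1 / (d : ℝ)) (ginibrePoly d) (ginibreAdjPoly d) p := by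
  set ψ : MvPolynomial (EntryIdx d) ℝ →ₐ[ℝ] _ := (entrySubst d 1).comp (shift (entryMean d))
    with hψ
  set g := ginibrePoly d
  set g' := ginibreAdjPoly d
  have h1 : ψ.mapMatrix (entryMatrix d) = g ⊗ₖ g'ᵀ := by
    ext1 u v
    exact entrySubst_shift_X (u, v)
  have h2 : ψ.mapMatrix (entryAdjMatrix d) = g' ⊗ₖ gᵀ := by
    ext1 u v
    refine (entrySubst_shift_X (v.swap, u.swap)).trans (mul_comm _ _)
  have h3 : ψ.mapMatrix (entryMatrix d * entryAdjMatrix d) = (g * g') ⊗ₖ (g * g')ᵀ := by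
    rw [map_mul, h1, h2, Matrix.transpose_mul, Matrix.mul_kronecker_mul]
  have h4 : ∀ p, ((g * g') ⊗ₖ (g * g')ᵀ) ^ p = ((g * g') ^ p) ⊗ₖ ((g * g') ^ p)ᵀ := by
    intro p
    induction p with
    | zero => simp
    | succ p ih =>
      rw [pow_succ, ih, ← Matrix.mul_kronecker_mul, ← Matrix.transpose_mul, ← pow_succ, ← pow_succ']
  have h5 : ψ ((entryMatrix d * entryAdjMatrix d) ^ p).trace =
      (ψ.mapMatrix ((entryMatrix d * entryAdjMatrix d) ^ p)).trace := by
    simp [Matrix.trace]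
  change ψ (tracePoly d p) = _
  rw [tracePoly, traceMoment, map_mul, AlgHom.commutes, h5, map_pow, h3, h4,
    Matrix.trace_kronecker, Matrix.trace_transpose, traceMoment]
  have : (1 / (d : ℝ) ^ 2) = 1 / d * (1 / d) := by field_simp
  rw [this, map_mul]
  ring

variable {Ω : Type*} [MeasurableSpace Ω] {P : Measure Ω} [IsProbabilityMeasure P]

/-- Restoring the nonnegative mean can only increase the moment. The list is doubled because each
trace becomes the square of a Ginibre trace. -/
theorem entryExpectation_le_ginibre (hd : 0 < d) {ζ : (Fin d × Fin d) × Fin 1 → Ω → ℂ}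
    (hl : ∀ v, HasLaw (ζ v) stdComplexGaussian P) (hi : iIndepFun ζ P) (L : List ℕ) :
    entryExpectation hl (L.map (tracePoly d)).prod ≤ gaussianExpectation hl
      ((L ++ L).map (traceMoment (1 / (d : ℝ)) (ginibrePoly d) (ginibreAdjPoly d))).prod := by
  have hE := isLoopFunctional_entryExpectation hd one_pos hl hi
  have h := hE.nonneg (by positivity) posPoly_linkDeriv_X posPoly_pairDeriv_X
    ((isPos_prod_tracePoly d L).shift_sub (δ := entryMean d) fun b => by
      unfold entryMean; split_ifs <;> positivity)
  rw [map_sub, sub_nonneg] at h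
  refine h.trans (le_of_eq ?_)
  rw [entryExpectation, LinearMap.comp_apply, AlgHom.toLinearMap_apply, map_list_prod,
    map_list_prod, List.map_map, List.map_map, List.map_append, List.prod_append,
    ← List.prod_map_mul]
  congr 3
  funext p
  exact entrySubst_shift_tracePoly hd p

theorem exists_bound_tracePoly {Ω : ℕ → Type*} [∀ d, MeasurableSpace (Ω d)]
    {P : ∀ d, Measure (Ω d)} [∀ d, IsProbabilityMeasure (P d)]
    {ζ : ∀ d, (Fin d × Fin d) × Fin 1 → Ω d → ℂ}
    (hl : ∀ d v, HasLaw (ζ d v) stdComplexGaussian (P d)) (hi : ∀ d, iIndepFun (ζ d) (P d))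
    (L : List ℕ) : ∃ C : ℝ, ∀ d, 0 < d → entryExpectation (hl d) (L.map (tracePoly d)).prod ≤ C := by
  obtain ⟨C, hC⟩ := exists_bound_ginibrePoly hl hi (L ++ L)
  exact ⟨C, fun d hd => (entryExpectation_le_ginibre hd (hl d) (hi d) L).trans
    ((le_abs_self _).trans (hC d hd))⟩

/-- Summed over the entries, the bounds of `IsLoopFunctional.abs_sub_le` reassemble into one mixed
trace moment of the case s = 1. -/
theorem abs_loopRemainder_le {Ω₁ : Type*} [MeasurableSpace Ω₁] {P₁ : Measure Ω₁}
    [IsProbabilityMeasure P₁] (hd : 0 < d) (hs : 0 < s)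
    {ζ : (Fin d × Fin d) × Fin s → Ω → ℂ} {ζ₁ : (Fin d × Fin d) × Fin 1 → Ω₁ → ℂ}
    (hl : ∀ v, HasLaw (ζ v) stdComplexGaussian P) (hi : iIndepFun ζ P)
    (hl₁ : ∀ v, HasLaw (ζ₁ v) stdComplexGaussian P₁) (hi₁ : iIndepFun ζ₁ P₁)
    (p : ℕ) (L : List ℕ) :
    |loopRemainder (1 / (d : ℝ) ^ 2) (entryMatrix d) (entryAdjMatrix d)
      (fun a b => pairDeriv d (a, b)) (entryExpectation hl) p L| ≤
      1 / √(s : ℝ) * entryExpectation hl₁ (((p + 1) :: L).map (tracePoly d)).prod := by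
  have hE := isLoopFunctional_entryExpectation hd hs hl hi
  have hE₁ := isLoopFunctional_entryExpectation hd one_pos hl₁ hi₁
  rw [Nat.cast_one, Real.sqrt_one, div_one] at hE₁
  have hs1 : 1 / √(s : ℝ) ≤ 1 := by
    refine div_le_one_of_le₀ ?_ (by positivity)
    rw [Real.one_le_sqrt]
    exact_mod_cast hs
  have hpos : ∀ a b, IsPos ((entryAdjMatrix d * (entryMatrix d * entryAdjMatrix d) ^ p) b a *
      (L.map (tracePoly d)).prod) := fun a b =>
    (IsPos.matrix_mul isPos_entryAdjMatrix (IsPos.matrix_pow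
      (IsPos.matrix_mul isPos_entryMatrix isPos_entryAdjMatrix) p) b a).mul
      (isPos_prod_tracePoly d L)
  have e : entryExpectation hl₁ (((p + 1) :: L).map (tracePoly d)).prod = 1 / (d : ℝ) ^ 2 *
      ∑ a, ∑ b, entryExpectation hl₁ (MvPolynomial.X (a, b) *
        ((entryAdjMatrix d * (entryMatrix d * entryAdjMatrix d) ^ p) b a *
          (L.map (tracePoly d)).prod)) := by
    rw [List.map_cons, List.prod_cons, tracePoly, traceMoment_succ_mul, ← Algebra.smul_def,
      map_smul, map_sum, smul_eq_mul]
    simp only [map_sum]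
    rfl
  rw [loopRemainder, abs_mul, abs_of_nonneg (by positivity), e, mul_left_comm]
  refine mul_le_mul_of_nonneg_left ?_ (by positivity)
  refine (Finset.abs_sum_le_sum_abs _ _).trans ?_
  rw [Finset.mul_sum]
  refine Finset.sum_le_sum fun a _ => (Finset.abs_sum_le_sum_abs _ _).trans ?_
  rw [Finset.mul_sum]
  exact Finset.sum_le_sum fun b _ => hE.abs_sub_le hE₁ (by positivity) hs1 posPoly_linkDeriv_X
    posPoly_pairDeriv_X (hpos a b) (a, b)

/-- The mixed moments of the normalized traces converge to products of Catalan numbers. -/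
theorem tendsto_entryExpectation_prod_tracePoly {Ω : ℕ → ℕ → Type*}
    [∀ d s, MeasurableSpace (Ω d s)]
    {P : ∀ d s, Measure (Ω d s)} [∀ d s, IsProbabilityMeasure (P d s)]
    {ζ : ∀ d s, (Fin d × Fin d) × Fin s → Ω d s → ℂ}
    (hl : ∀ d s v, HasLaw (ζ d s v) stdComplexGaussian (P d s))
    (hi : ∀ d s, iIndepFun (ζ d s) (P d s)) (L : List ℕ) :
    Tendsto (fun ds : ℕ × ℕ => entryExpectation (hl ds.1 ds.2) (L.map (tracePoly ds.1)).prod)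
      (atTop ×ˢ atTop) (𝓝 ((L.map fun p => (catalan p : ℝ)).prod)) := by
  have hd : ∀ᶠ ds : ℕ × ℕ in atTop ×ˢ atTop, 0 < ds.1 :=
    tendsto_fst.eventually (eventually_gt_atTop 0)
  have hs : ∀ᶠ ds : ℕ × ℕ in atTop ×ˢ atTop, 0 < ds.2 :=
    tendsto_snd.eventually (eventually_gt_atTop 0)
  refine tendsto_of_isTraceRecursion (ε := 1) (c := fun ds : ℕ × ℕ => 1 / (ds.1 : ℝ) ^ 2)
    (m := fun ds L => entryExpectation (hl ds.1 ds.2) (L.map (tracePoly ds.1)).prod)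
    (rem := fun ds => loopRemainder (1 / (ds.1 : ℝ) ^ 2) (entryMatrix ds.1) (entryAdjMatrix ds.1)
      (fun a b => pairDeriv ds.1 (a, b)) (entryExpectation (hl ds.1 ds.2)))
    ?_ ?_ ?_ L
  · filter_upwards [hd, hs] with ds hd hs
    exact (isGinibreDeriv_entryMatrix hd).isTraceRecursion
      (isLoopFunctional_entryExpectation hd hs (hl _ _) (hi _ _)).map_one
  · have h1 : Tendsto (fun n : ℕ => 1 / (n : ℝ) ^ 2) atTop (𝓝 0) := by
      simpa using (tendsto_one_div_atTop_nhds_zero_nat (𝕜 := ℝ)).pow 2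
    exact h1.comp tendsto_fst
  · intro p L
    -- The constant depends on `p` and `L` but not on `d`, so the remainder vanishes as s grows
    -- whatever the relative size of d.
    obtain ⟨C, hC⟩ := exists_bound_tracePoly (fun d => hl d 1) (fun d => hi d 1) ((p + 1) :: L)
    have h1 : Tendsto (fun n : ℕ => 1 / √(n : ℝ) * C) atTop (𝓝 0) := by
      have := (Real.tendsto_sqrt_atTop.comp (tendsto_natCast_atTop_atTop (R := ℝ))).inv_tendsto_atTop
      simpa using this.mul_const C
    refine squeeze_zero_norm' ?_ (h1.comp tendsto_snd)
    filter_upwards [hd, hs] with ds hd hs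
    exact (abs_loopRemainder_le hd hs (hl _ _) (hi _ _) (hl ds.1 1) (hi ds.1 1) p L).trans
      (mul_le_mul_of_nonneg_left (hC _ hd) (by positivity))

end EntryMatrix

/-! ### Traces as power sums of singular values -/

section SingularValues

variable {d : ℕ}

/-- Singular values are read off from the eigenvalues of `Aᴴ * A`, whereas `normTrace` involves `A *
Aᴴ`. -/
theorem trace_mul_conjTranspose_pow {n : Type*} [Fintype n] [DecidableEq n] (A : Matrix n n ℂ)
    (p : ℕ) : ((A * Aᴴ) ^ p).trace = ((Aᴴ * A) ^ p).trace := by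
  have h : ∀ p, (A * Aᴴ) ^ (p + 1) = A * (Aᴴ * A) ^ p * Aᴴ := by
    intro p
    induction p with
    | zero => simp
    | succ p ih => rw [pow_succ, ih, pow_succ (Aᴴ * A)]; noncomm_ring
  cases p with
  | zero => simp
  | succ p => rw [h, Matrix.trace_mul_comm, ← mul_assoc, ← pow_succ']

theorem trace_pow_eq_sum_singularValue
    (A : Matrix (Fin d × Fin d) (Fin d × Fin d) ℂ) (p : ℕ) :
    ((A * Aᴴ) ^ p).trace.re = ∑ i, singularValue A i ^ (2 * p) := by
  set T := Matrix.toEuclideanLin A with hT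
  have hn : Module.finrank ℂ (EuclideanSpace ℂ (Fin d × Fin d)) = d ^ 2 := by
    simp [sq]
  set hS := T.isSymmetric_adjoint_comp_self
  have hev : ∀ i, (T.adjoint ∘ₗ T) (hS.eigenvectorBasis hn i) =
      ((singularValue A i ^ 2 : ℝ) : ℂ) • hS.eigenvectorBasis hn i := by
    intro i
    rw [hS.apply_eigenvectorBasis hn i, singularValue, ← T.sq_singularValues_fin hn]
    rfl
  have hpow : ∀ p i, ((T.adjoint ∘ₗ T) ^ p) (hS.eigenvectorBasis hn i) =
      ((singularValue A i ^ (2 * p) : ℝ) : ℂ) • hS.eigenvectorBasis hn i := by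
    intro p i
    induction p with
    | zero => simp
    | succ p ih =>
      rw [pow_succ', Module.End.mul_apply, ih, map_smul, hev, smul_smul]
      congr 1
      push_cast
      ring
  have htr : LinearMap.trace ℂ _ ((T.adjoint ∘ₗ T) ^ p) = ((Aᴴ * A) ^ p).trace := by
    have h1 : ∀ p, (T.adjoint ∘ₗ T) ^ p = Matrix.toLin
        (EuclideanSpace.basisFun (Fin d × Fin d) ℂ).toBasis
        (EuclideanSpace.basisFun (Fin d × Fin d) ℂ).toBasis ((Aᴴ * A) ^ p) := by
      intro p
      have h2 : T.adjoint ∘ₗ T = Matrix.toLin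
        (EuclideanSpace.basisFun (Fin d × Fin d) ℂ).toBasis
        (EuclideanSpace.basisFun (Fin d × Fin d) ℂ).toBasis (Aᴴ * A) := by
        rw [hT, ← Matrix.toEuclideanLin_conjTranspose_eq_adjoint,
          Matrix.toEuclideanLin_eq_toLin_orthonormal, ← Matrix.toLin_mul]
      induction p with
      | zero => simp [Matrix.toLin_one, Module.End.one_eq_id]
      | succ p ih =>
        rw [pow_succ, ih, h2, Module.End.mul_eq_comp, ← Matrix.toLin_mul, ← pow_succ]
    rw [h1, Matrix.trace_toLin_eq]
  rw [trace_mul_conjTranspose_pow, ← htr, LinearMap.trace_eq_sum_inner _ (hS.eigenvectorBasis hn)]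
  simp only [hpow, inner_smul_right, orthonormal_iff_ite.1 (hS.eigenvectorBasis hn).orthonormal,
    if_true, mul_one, Complex.re_sum, Complex.ofReal_re]

theorem singularValue_nonneg (A : Matrix (Fin d × Fin d) (Fin d × Fin d) ℂ) (i : Fin (d ^ 2)) :
    0 ≤ singularValue A i := LinearMap.singularValues_nonneg _ _

variable {s : ℕ} (X : Matrix (Fin d × Fin d) (Fin s) ℂ)

theorem normTrace_eq_sum (p : ℕ) :
    normTrace X p = 1 / (d : ℝ) ^ 2 * ∑ i, singularValue (Q X) i ^ (2 * p) := by
  rw [normTrace, trace_pow_eq_sum_singularValue]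

theorem singularValueMoment_eq_sum (k : ℕ) :
    singularValueMoment X k = 1 / (d : ℝ) ^ 2 * ∑ i, singularValue (Q X) i ^ k := by
  rw [singularValueMoment, empiricalSingularValueDist, integral_smul_measure,
    integral_finsetSum_measure fun i _ => integrable_dirac (by simp)]
  simp [integral_dirac]

end SingularValues

/-! ### Evaluation of the formal polynomials at the random matrix -/

section Evaluation

variable {d s : ℕ} {Ω : Type*} (X : Ω → Matrix (Fin d × Fin d) (Fin s) ℂ) (ω : Ω)

theorem gaussianEval_entryPoly (c : EntryIdx d) :
    gaussianEval (fun (v : (Fin d × Fin d) × Fin s) ω => X ω v.1 v.2) ω (entryPoly d s c) =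
      Q (X ω) c.1 c.2 := by
  have hd : (d : ℝ) ≠ 0 := by
    have := c.1.1.pos
    positivity
  have hψ : ∀ u : Fin d × Fin d, maxEntangledVec d u =
      ((1 / √(d : ℝ) : ℝ) : ℂ) * if u.1 = u.2 then 1 else 0 := by
    intro u
    simp only [maxEntangledVec, Pi.smul_apply, Finset.sum_apply, Pi.single_apply, smul_eq_mul]
    congr 1
    rcases u with ⟨i, j⟩
    by_cases h : i = j
    · subst h; simp
    · have : ∀ x, ¬ (i = x ∧ j = x) := fun x hx => h (hx.1.trans hx.2.symm)
      simp [h, this]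
  have h1 : ((1 / √(d : ℝ) : ℝ) : ℂ) * ((1 / √(d : ℝ) : ℝ) : ℂ) = 1 / (d : ℂ) := by
    rw [← Complex.ofReal_mul, div_mul_div_comm, Real.mul_self_sqrt (by positivity)]
    simp
  have hE : maxEntangledState d c.1 c.2 =
      1 / (d : ℂ) * if c.1.1 = c.1.2 ∧ c.2.1 = c.2.2 then 1 else 0 := by
    rw [maxEntangledState, Matrix.vecMulVec_apply, Pi.star_apply, hψ, hψ, star_mul', ← h1]
    by_cases h : c.1.1 = c.1.2 <;> by_cases h' : c.2.1 = c.2.2 <;> simp [h, h', RCLike.star_def]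
  have hdc : (d : ℂ) ≠ 0 := by exact_mod_cast hd
  rw [Q, Matrix.smul_apply, Matrix.sub_apply, Matrix.smul_apply, hE, entryPoly, map_mul, map_sub,
    smul_eq_mul, smul_eq_mul, realign, Matrix.of_apply, wishart, Matrix.mul_apply, map_sum]
  simp only [map_mul, gaussianEval, MvPolynomial.aeval_X, gaussianValue, MvPolynomial.aeval_C,
    Bool.false_eq_true, if_false, if_true, Matrix.conjTranspose_apply]
  congr 2
  split_ifs
  · simp; field_simp
  · simp

theorem gaussianEval_tracePoly (p : ℕ) :
    gaussianEval (fun (v : (Fin d × Fin d) × Fin s) ω => X ω v.1 v.2) ω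
      (entrySubst d s (tracePoly d p)) = (normTrace (X ω) p : ℂ) := by
  set ψ : MvPolynomial (EntryIdx d) ℝ →ₐ[ℝ] ℂ :=
    (gaussianEval (fun (v : (Fin d × Fin d) × Fin s) ω => X ω v.1 v.2) ω).comp (entrySubst d s)
  have hX : ∀ c, ψ (MvPolynomial.X c) = Q (X ω) c.1 c.2 := by
    intro c
    rw [← gaussianEval_entryPoly]
    simp [ψ, entrySubst]
  have h1 : ψ.mapMatrix (entryMatrix d) = Q (X ω) := by
    ext1 u v; exact hX (u, v)
  -- Conjugation exchanges the two Gaussian factors of each product in an entry, hence swaps both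
  -- index pairs; this is the real structure built into `entryAdjMatrix`.
  have h2 : ψ.mapMatrix (entryAdjMatrix d) = (Q (X ω))ᴴ := by
    ext1 u v
    refine (hX (v.swap, u.swap)).trans ?_
    rw [Matrix.conjTranspose_apply, ← gaussianEval_entryPoly X ω (v, u),
      ← gaussianEval_entryPoly X ω (v.swap, u.swap)]
    simp only [entryPoly, map_mul, map_sub, map_sum, gaussianEval, MvPolynomial.aeval_X,
      gaussianValue, MvPolynomial.aeval_C, Bool.false_eq_true, if_false, if_true, star_mul',
      star_sub, star_sum, Prod.fst_swap, Prod.snd_swap]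
    simp [mul_comm, eq_comm]
  change ψ (tracePoly d p) = _
  have h5 : ψ ((entryMatrix d * entryAdjMatrix d) ^ p).trace =
      (ψ.mapMatrix ((entryMatrix d * entryAdjMatrix d) ^ p)).trace := by
    simp [Matrix.trace]
  have h6 : (normTrace (X ω) p : ℂ) =
      ((1 / (d : ℝ) ^ 2 : ℝ) : ℂ) * ((Q (X ω) * (Q (X ω))ᴴ) ^ p).trace := by
    rw [← ofReal_re_trace_pow, ← Complex.ofReal_mul]
    rfl
  rw [tracePoly, traceMoment, map_mul, AlgHom.commutes, h5, map_pow, map_mul, h1, h2, h6]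
  rfl

variable {X} [MeasurableSpace Ω] {P : Measure Ω} [IsProbabilityMeasure P]

theorem hasAllMoments_normTrace (hX : IsGaussianMatrix X P) (p : ℕ) :
    HasAllMoments (fun ω => (normTrace (X ω) p : ℂ)) P := by
  rw [funext fun ω => (gaussianEval_tracePoly X ω p).symm]
  exact hasAllMoments_gaussianEval
    (ζ := fun (v : (Fin d × Fin d) × Fin s) ω => X ω v.1 v.2) (fun v => hX.law v.1 v.2) _

theorem memLp_normTrace (hX : IsGaussianMatrix X P) (p n : ℕ) :
    MemLp (fun ω => normTrace (X ω) p) n P := by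
  simpa using (hasAllMoments_normTrace hX p n).re

theorem integral_prod_normTrace (hX : IsGaussianMatrix X P) (L : List ℕ) :
    ∫ ω, (L.map (normTrace (X ω))).prod ∂P =
      entryExpectation (ζ := fun (v : (Fin d × Fin d) × Fin s) ω => X ω v.1 v.2)
        (fun v => hX.law v.1 v.2) (L.map (tracePoly d)).prod := by
  simp only [entryExpectation, LinearMap.comp_apply, AlgHom.toLinearMap_apply, gaussianExpectation,
    LinearMap.coe_mk, AddHom.coe_mk, map_list_prod, List.map_map]
  have : ∀ ω, (L.map (⇑(gaussianEval (fun (v : (Fin d × Fin d) × Fin s) ω => X ω v.1 v.2) ω) ∘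
      ⇑(entrySubst d s) ∘ tracePoly d)).prod = (((L.map (normTrace (X ω))).prod : ℝ) : ℂ) := by
    intro ω
    rw [← Complex.coe_algebraMap, map_list_prod, List.map_map]
    congr 2
    funext p
    exact gaussianEval_tracePoly X ω p
  simp only [this]
  rw [integral_complex_ofReal, Complex.ofReal_re]

end Evaluation

/-! ### Moments of the quarter-circle distribution -/

section QuarterCircle

theorem measurable_quarterCircle_density :
    Measurable fun x : ℝ => ENNReal.ofReal (√(4 - x ^ 2) / Real.pi) := by fun_prop

theorem quarterCircle_eq_withDensity : quarterCircle =
    (volume.restrict (Set.Icc (0 : ℝ) 2)).withDensity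
      fun x => ENNReal.ofReal (√(4 - x ^ 2) / Real.pi) := by
  rw [quarterCircle, withDensity_indicator measurableSet_Icc]

theorem integrable_quarterCircle {f : ℝ → ℝ} (hf : Continuous f) : Integrable f quarterCircle := by
  rw [quarterCircle_eq_withDensity, integrable_withDensity_iff_integrable_smul₀'
    measurable_quarterCircle_density.aemeasurable (by simp)]
  have : ContinuousOn (fun x => (ENNReal.ofReal (√(4 - x ^ 2) / Real.pi)).toReal • f x)
      (Set.Icc (0 : ℝ) 2) := by
    have h : ∀ x : ℝ, (ENNReal.ofReal (√(4 - x ^ 2) / Real.pi)).toReal = √(4 - x ^ 2) / Real.pi :=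
      fun x => ENNReal.toReal_ofReal (by positivity)
    simp only [h]
    fun_prop
  exact this.integrableOn_Icc

theorem integral_quarterCircle (f : ℝ → ℝ) :
    ∫ x, f x ∂quarterCircle = (∫ x in (0 : ℝ)..2, f x * √(4 - x ^ 2)) / Real.pi := by
  rw [quarterCircle_eq_withDensity, integral_withDensity_eq_integral_toReal_smul₀
    measurable_quarterCircle_density.aemeasurable (by simp), integral_Icc_eq_integral_Ioc,
    ← intervalIntegral.integral_of_le zero_le_two, ← intervalIntegral.integral_div]
  refine intervalIntegral.integral_congr fun x _ => ?_
  simp only [smul_eq_mul]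
  rw [ENNReal.toReal_ofReal (by positivity)]
  ring

theorem ae_nonneg_quarterCircle : ∀ᵐ x ∂quarterCircle, 0 ≤ x := by
  rw [quarterCircle_eq_withDensity]
  refine (withDensity_absolutelyContinuous _ _).ae_le ?_
  filter_upwards [ae_restrict_mem measurableSet_Icc] with x hx using hx.1

theorem four_pow_mul_prod_eq_centralBinom (p : ℕ) :
    (4 : ℝ) ^ p * ∏ i ∈ Finset.range p, (2 * (i : ℝ) + 1) / (2 * i + 2) = p.centralBinom := by
  induction p with
  | zero => simp
  | succ p ih =>
    have h : ((p : ℝ) + 1) * (p + 1).centralBinom = 2 * (2 * p + 1) * p.centralBinom := by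
      exact_mod_cast p.succ_mul_centralBinom_succ
    have hp : (p : ℝ) + 1 ≠ 0 := by positivity
    rw [Finset.prod_range_succ, pow_succ]
    apply mul_left_cancel₀ hp
    rw [h, ← ih]
    field_simp
    ring

/-- The even moments of the quarter-circle distribution are the Catalan numbers. -/
theorem integral_pow_quarterCircle (p : ℕ) : ∫ x, x ^ (2 * p) ∂quarterCircle = catalan p := by
  have h1 : ∫ x in (0 : ℝ)..2, x ^ (2 * p) * √(4 - x ^ 2) =
      ∫ θ in (0 : ℝ)..(Real.pi / 2), 4 ^ (p + 1) * (Real.cos θ ^ (2 * p) - Real.cos θ ^ (2 * (p + 1)))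
      := by
    -- The substitution x = 2 cos θ is decreasing, hence the endpoints π/2 and 0 in this order. It
    -- leads to Wallis integrals.
    have h := intervalIntegral.integral_comp_mul_deriv (a := Real.pi / 2) (b := 0)
      (f := fun θ => 2 * Real.cos θ) (f' := fun θ => 2 * -Real.sin θ)
      (g := fun x => x ^ (2 * p) * √(4 - x ^ 2))
      (fun θ _ => (Real.hasDerivAt_cos θ).const_mul 2) (by fun_prop) (by fun_prop)
    simp only [Real.cos_pi_div_two, mul_zero, Real.cos_zero, mul_one] at h
    rw [← h, intervalIntegral.integral_symm, ← intervalIntegral.integral_neg]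
    refine intervalIntegral.integral_congr fun θ hθ => ?_
    rw [Set.uIcc_of_le (by positivity)] at hθ
    have hs : 0 ≤ Real.sin θ := Real.sin_nonneg_of_nonneg_of_le_pi hθ.1
      (hθ.2.trans (by linarith [Real.pi_pos]))
    have h2 : 4 - (2 * Real.cos θ) ^ 2 = (2 * Real.sin θ) ^ 2 := by
      nlinarith [Real.sin_sq_add_cos_sq θ]
    have h3 : Real.sin θ ^ 2 = 1 - Real.cos θ ^ 2 := by
      linarith [Real.sin_sq_add_cos_sq θ]
    simp only [Function.comp]
    rw [h2, Real.sqrt_sq (by positivity), mul_pow, pow_mul 2 2 p]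
    norm_num
    linear_combination (4 * 4 ^ p * Real.cos θ ^ (2 * p)) * h3
  have hI : ∀ n, IntervalIntegrable (fun θ => Real.cos θ ^ n) volume 0 (Real.pi / 2) := fun n =>
    (Real.continuous_cos.pow n).intervalIntegrable _ _
  have h4 : ∫ θ in (0 : ℝ)..(Real.pi / 2), (4 : ℝ) ^ (p + 1) *
      (Real.cos θ ^ (2 * p) - Real.cos θ ^ (2 * (p + 1))) = 4 ^ (p + 1) *
      (1 / 2 * (Real.pi * ∏ i ∈ Finset.range p, (2 * (i : ℝ) + 1) / (2 * i + 2)) -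
        1 / 2 * (Real.pi * ∏ i ∈ Finset.range (p + 1), (2 * (i : ℝ) + 1) / (2 * i + 2))) := by
    rw [intervalIntegral.integral_const_mul, intervalIntegral.integral_sub (hI _) (hI _),
      EulerSine.integral_cos_pow_eq, EulerSine.integral_cos_pow_eq, integral_sin_pow_even,
      integral_sin_pow_even]
  rw [integral_quarterCircle, h1, h4, Finset.prod_range_succ]
  have h5 : ((p : ℝ) + 1) * catalan p = p.centralBinom := by
    exact_mod_cast succ_mul_catalan_eq_centralBinom p
  have hp : (p : ℝ) + 1 ≠ 0 := by positivity
  apply mul_left_cancel₀ hp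
  rw [h5, ← four_pow_mul_prod_eq_centralBinom, pow_succ]
  have := Real.pi_ne_zero
  field_simp
  ring

instance : IsProbabilityMeasure quarterCircle := by
  have h := integral_pow_quarterCircle 0
  simp only [mul_zero, pow_zero, integral_const, smul_eq_mul, mul_one, catalan_zero,
    Nat.cast_one] at h
  constructor
  rwa [measureReal_def, ENNReal.toReal_eq_one_iff] at h

end QuarterCircle

/-! ### Polynomial approximation controlled by even moments -/

section Approximation

theorem catalan_le_four_pow (p : ℕ) : catalan p ≤ 4 ^ p := by
  have h1 := succ_mul_catalan_eq_centralBinom p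
  calc catalan p ≤ (p + 1) * catalan p := Nat.le_mul_of_pos_left _ (by omega)
    _ ≤ 4 ^ p := h1 ▸ p.centralBinom_le_four_pow

/-- Approximation of `y ↦ √y ^ k` by polynomials, with an error which is small on average for
distributions whose moments are the Catalan numbers. -/
theorem exists_polynomial_approx (k : ℕ) {δ : ℝ} (hδ : 0 < δ) :
    ∃ (r : Polynomial ℝ) (N : ℕ) (η₁ η₂ : ℝ),
      (∀ y, 0 ≤ y → |√y ^ k - r.eval y| ≤ η₁ + η₂ * y ^ N) ∧ η₁ + η₂ * catalan N < δ := by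
  -- The endpoint 5 exceeds the growth rate 4 of the Catalan numbers. Beyond it the error is at most
  -- C y^n (y/5)^j, and replacing the power of y by its Catalan number costs at most C 4^n (4/5)^j,
  -- small for large j.
  obtain ⟨r, hr⟩ := exists_polynomial_near_of_continuousOn 0 5 (fun y => √y ^ k)
    (by fun_prop) (δ / 2) (by positivity)
  set n := k + r.natDegree with hn
  set C : ℝ := 1 + ∑ i ∈ Finset.range (r.natDegree + 1), |r.coeff i| with hC
  have hC0 : 0 ≤ C := by positivity
  have hlarge : ∀ y, 1 ≤ y → |√y ^ k - r.eval y| ≤ C * y ^ n := by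
    intro y hy
    have hy0 : 0 ≤ y := by linarith
    have h1 : |√y ^ k| ≤ y ^ n := by
      rw [abs_of_nonneg (by positivity)]
      refine (pow_le_pow_left₀ (Real.sqrt_nonneg y) ?_ k).trans (pow_le_pow_right₀ hy (by omega))
      rw [Real.sqrt_le_left hy0]
      nlinarith
    have h2 : |r.eval y| ≤ (∑ i ∈ Finset.range (r.natDegree + 1), |r.coeff i|) * y ^ n := by
      rw [Polynomial.eval_eq_sum_range, Finset.sum_mul]
      refine (Finset.abs_sum_le_sum_abs _ _).trans (Finset.sum_le_sum fun i hi => ?_)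
      rw [abs_mul, abs_of_nonneg (pow_nonneg hy0 i)]
      refine mul_le_mul_of_nonneg_left (pow_le_pow_right₀ hy ?_) (abs_nonneg _)
      have := Finset.mem_range.1 hi
      omega
    calc |√y ^ k - r.eval y| ≤ |√y ^ k| + |r.eval y| := abs_sub _ _
      _ ≤ C * y ^ n := by rw [hC, add_mul, one_mul]; exact add_le_add h1 h2
  obtain ⟨j, hj⟩ : ∃ j : ℕ, C * 4 ^ n * (4 / 5 : ℝ) ^ j < δ / 2 := by
    have h := (tendsto_pow_atTop_nhds_zero_of_lt_one (by norm_num : (0 : ℝ) ≤ 4 / 5)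
      (by norm_num)).const_mul (C * 4 ^ n)
    rw [mul_zero] at h
    exact (h.eventually_lt_const (by positivity : (0 : ℝ) < δ / 2)).exists
  refine ⟨r, n + j, δ / 2, C / 5 ^ j, fun y hy => ?_, ?_⟩
  · by_cases h5 : y ≤ 5
    · have h := hr y ⟨hy, h5⟩
      rw [abs_sub_comm] at h
      exact h.le.trans (le_add_of_nonneg_right (by positivity))
    · push Not at h5
      refine (hlarge y (by linarith)).trans (le_trans ?_ (le_add_of_nonneg_left (by positivity)))
      have e : C / 5 ^ j * y ^ (n + j) = C * y ^ n * (y / 5) ^ j := by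
        rw [div_pow, pow_add y n j]
        ring
      rw [e]
      refine le_mul_of_one_le_right (by positivity) (one_le_pow₀ ?_)
      rw [le_div_iff₀ (by norm_num)]
      linarith
  · have h1 : (catalan (n + j) : ℝ) ≤ 4 ^ (n + j) := by exact_mod_cast catalan_le_four_pow _
    have h2 : C / 5 ^ j * catalan (n + j) ≤ C * 4 ^ n * (4 / 5 : ℝ) ^ j := by
      refine (mul_le_mul_of_nonneg_left h1 (by positivity)).trans (le_of_eq ?_)
      rw [pow_add, div_pow]
      ring
    linarith

/-- Integrates the approximation at y = x². It is used both for the empirical distribution and for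
its limit, which gives the two comparisons that `TendstoMeanSquare.of_approx` needs. -/
theorem abs_integral_pow_sub_le {μ : Measure ℝ} [IsProbabilityMeasure μ] (h0 : ∀ᵐ x ∂μ, 0 ≤ x)
    (hint : ∀ k : ℕ, Integrable (fun x => x ^ k) μ) {k N : ℕ} {r : Polynomial ℝ} {η₁ η₂ : ℝ}
    (h : ∀ y, 0 ≤ y → |√y ^ k - r.eval y| ≤ η₁ + η₂ * y ^ N) :
    |∫ x, x ^ k ∂μ - ∑ i ∈ Finset.range (r.natDegree + 1), r.coeff i * ∫ x, x ^ (2 * i) ∂μ| ≤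
      η₁ + η₂ * ∫ x, x ^ (2 * N) ∂μ := by
  have h1 : ∑ i ∈ Finset.range (r.natDegree + 1), r.coeff i * ∫ x, x ^ (2 * i) ∂μ =
      ∫ x, ∑ i ∈ Finset.range (r.natDegree + 1), r.coeff i * x ^ (2 * i) ∂μ := by
    rw [integral_finsetSum _ fun i _ => (hint _).const_mul _]
    simp only [integral_const_mul]
  have h2 : η₁ + η₂ * ∫ x, x ^ (2 * N) ∂μ = ∫ x, (η₁ + η₂ * x ^ (2 * N)) ∂μ := by
    rw [integral_add (integrable_const _) ((hint _).const_mul _), integral_const_mul]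
    simp
  have h3 : Integrable (fun x => ∑ i ∈ Finset.range (r.natDegree + 1), r.coeff i * x ^ (2 * i)) μ :=
    integrable_finsetSum _ fun i _ => (hint _).const_mul _
  rw [h1, h2, ← integral_sub (hint k) h3]
  refine (abs_integral_le_integral_abs).trans (integral_mono_ae ((hint k).sub h3).abs
    ((integrable_const _).add ((hint _).const_mul _)) ?_)
  filter_upwards [h0] with x hx
  have h4 := h (x ^ 2) (by positivity)
  rw [Real.sqrt_sq hx, Polynomial.eval_eq_sum_range] at h4
  simpa only [pow_mul] using h4

end Approximation

/-! ### Mean square convergence to constants -/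

section MeanSquare

variable {α : Type*} {l : Filter α} {Ω : α → Type*} [∀ a, MeasurableSpace (Ω a)]
  {P : ∀ a, Measure (Ω a)}

/-- Convergence in mean square to a constant of random variables on varying probability spaces. -/
structure TendstoMeanSquare (P : ∀ a, Measure (Ω a)) (l : Filter α) (Y : ∀ a, Ω a → ℝ) (c : ℝ) :
    Prop where
  memLp : ∀ a, MemLp (Y a) 2 (P a)
  tendsto : Tendsto (fun a => ∫ ω, (Y a ω - c) ^ 2 ∂(P a)) l (𝓝 0)

namespace TendstoMeanSquare

variable {Y Z : ∀ a, Ω a → ℝ} {b c : ℝ}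

theorem const_mul (r : ℝ) (h : TendstoMeanSquare P l Y c) :
    TendstoMeanSquare P l (fun a ω => r * Y a ω) (r * c) where
  memLp a := (h.memLp a).const_mul r
  tendsto := by
    have h1 := h.tendsto.const_mul (r ^ 2)
    rw [mul_zero] at h1
    refine h1.congr fun a => ?_
    rw [← integral_const_mul]
    congr 1
    funext ω
    ring

variable [∀ a, IsProbabilityMeasure (P a)]

theorem memLp_sub (h : TendstoMeanSquare P l Y c) (a : α) : MemLp (fun ω => Y a ω - c) 2 (P a) :=
  (h.memLp a).sub (memLp_const c)

theorem integral_sq_eq (h : TendstoMeanSquare P l Y c) (a : α) :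
    ∫ ω, (Y a ω - c) ^ 2 ∂(P a) = variance (Y a) (P a) + (∫ ω, Y a ω ∂(P a) - c) ^ 2 := by
  have h1 := variance_eq_sub (h.memLp_sub a)
  rw [variance_sub_const (h.memLp a).aestronglyMeasurable,
    integral_sub ((h.memLp a).integrable one_le_two) (integrable_const _)] at h1
  simp only [integral_const, probReal_univ, one_smul] at h1
  rw [h1]
  simp only [Pi.pow_apply]
  ring

theorem tendsto_mean (h : TendstoMeanSquare P l Y c) :
    Tendsto (fun a => ∫ ω, Y a ω ∂(P a)) l (𝓝 c) := by
  have h1 : Tendsto (fun a => (∫ ω, Y a ω ∂(P a) - c) ^ 2) l (𝓝 0) :=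
    squeeze_zero (fun a => sq_nonneg _) (fun a => by
      rw [h.integral_sq_eq]
      exact le_add_of_nonneg_left (variance_nonneg _ _)) h.tendsto
  have h2 := (Real.continuous_sqrt.tendsto 0).comp h1
  simp only [Function.comp_def, Real.sqrt_sq_eq_abs, Real.sqrt_zero] at h2
  have h3 := (tendsto_zero_iff_abs_tendsto_zero _).2 h2
  simpa using h3.add_const c

theorem tendsto_variance (h : TendstoMeanSquare P l Y c) :
    Tendsto (fun a => variance (Y a) (P a)) l (𝓝 0) :=
  squeeze_zero (fun a => variance_nonneg _ _) (fun a => by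
      rw [h.integral_sq_eq]
      exact le_add_of_nonneg_right (sq_nonneg _)) h.tendsto

theorem const (c : ℝ) : TendstoMeanSquare P l (fun _ _ => c) c where
  memLp _ := memLp_const c
  tendsto := by simpa using tendsto_const_nhds

theorem add (hY : TendstoMeanSquare P l Y b) (hZ : TendstoMeanSquare P l Z c) :
    TendstoMeanSquare P l (fun a ω => Y a ω + Z a ω) (b + c) where
  memLp a := (hY.memLp a).add (hZ.memLp a)
  tendsto := by
    have h1 := (hY.tendsto.add hZ.tendsto).const_mul 2
    rw [add_zero, mul_zero] at h1
    refine squeeze_zero (fun a => integral_nonneg fun ω => sq_nonneg _) (fun a => ?_) h1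
    rw [← integral_add (hY.memLp_sub a).integrable_sq (hZ.memLp_sub a).integrable_sq,
      ← integral_const_mul]
    refine integral_mono (((hY.memLp a).add (hZ.memLp a)).sub (memLp_const (b + c))).integrable_sq
      (((hY.memLp_sub a).integrable_sq.add (hZ.memLp_sub a).integrable_sq).const_mul 2)
      fun ω => ?_
    change (Y a ω + Z a ω - (b + c)) ^ 2 ≤ 2 * ((Y a ω - b) ^ 2 + (Z a ω - c) ^ 2)
    nlinarith [sq_nonneg (Y a ω - b - (Z a ω - c))]

theorem sum {κ : Type*} (S : Finset κ) {Y : κ → ∀ a, Ω a → ℝ} {c : κ → ℝ}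
    (h : ∀ k ∈ S, TendstoMeanSquare P l (Y k) (c k)) :
    TendstoMeanSquare P l (fun a ω => ∑ k ∈ S, Y k a ω) (∑ k ∈ S, c k) := by
  classical
  induction S using Finset.induction_on with
  | empty => simpa using const 0
  | insert k S hk ih =>
    simp only [Finset.sum_insert hk]
    exact (h k (by simp)).add (ih fun j hj => h j (by simp [hj]))

/-- A random variable which can be approximated by mean square convergent ones, uniformly up to
errors with arbitrarily small limits, converges in mean square. -/
theorem of_approx {A : ∀ a, Ω a → ℝ} (hA : ∀ a, MemLp (A a) 2 (P a))
    (h : ∀ δ > 0, ∃ (B D : ∀ a, Ω a → ℝ) (b e : ℝ), TendstoMeanSquare P l B b ∧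
      TendstoMeanSquare P l D e ∧ (∀ᶠ a in l, ∀ ω, |A a ω - B a ω| ≤ D a ω) ∧
      |c - b| ≤ e ∧ e < δ) : TendstoMeanSquare P l A c where
  memLp := hA
  tendsto := by
    rw [Metric.tendsto_nhds]
    intro ε hε
    -- Since |A - c| ≤ |B - b| + |D - e| + 2e, the square is at most 3((B - b)² + (D - e)²) + 12e².
    -- The choice of 24 makes 12e² < ε/2.
    obtain ⟨B, D, b, e, hB, hD, hAB, hcb, heδ⟩ := h (√(ε / 24)) (by positivity)
    have he : 0 ≤ e := (abs_nonneg _).trans hcb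
    have he2 : e ^ 2 < ε / 24 := by
      rw [← Real.lt_sqrt he]
      exact heδ
    have h1 := ((hB.tendsto.add hD.tendsto).const_mul 3)
    rw [add_zero, mul_zero] at h1
    filter_upwards [hAB, h1.eventually_lt_const (by positivity : 0 < ε / 2)] with a ha h2
    rw [Real.dist_eq, sub_zero, abs_of_nonneg (integral_nonneg fun ω => sq_nonneg _)]
    have h3 : ∫ ω, (A a ω - c) ^ 2 ∂(P a) ≤
        ∫ ω, (3 * ((B a ω - b) ^ 2 + (D a ω - e) ^ 2) + 12 * e ^ 2) ∂(P a) := by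
      refine integral_mono ((hA a).sub (memLp_const c)).integrable_sq
        ((((hB.memLp_sub a).integrable_sq.add (hD.memLp_sub a).integrable_sq).const_mul 3).add
          (integrable_const _)) fun ω => ?_
      have h4 := ha ω
      change (A a ω - c) ^ 2 ≤ 3 * ((B a ω - b) ^ 2 + (D a ω - e) ^ 2) + 12 * e ^ 2
      have h5 : |A a ω - c| ≤ |B a ω - b| + |D a ω - e| + 2 * e := by
        have h6 : A a ω - c = (A a ω - B a ω) + (B a ω - b) - (c - b) := by ring
        rw [h6]
        refine (abs_sub _ _).trans ?_
        have h7 := abs_add_le (A a ω - B a ω) (B a ω - b)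
        have h8 := le_abs_self (D a ω - e)
        linarith
      rw [← sq_abs (A a ω - c), ← sq_abs (B a ω - b), ← sq_abs (D a ω - e)]
      refine (pow_le_pow_left₀ (abs_nonneg _) h5 2).trans ?_
      nlinarith [sq_nonneg (|B a ω - b| - |D a ω - e|), sq_nonneg (|B a ω - b| - 2 * e),
        sq_nonneg (|D a ω - e| - 2 * e)]
    refine h3.trans_lt ?_
    have hI : Integrable (fun ω => 3 * ((B a ω - b) ^ 2 + (D a ω - e) ^ 2)) (P a) :=
      ((hB.memLp_sub a).integrable_sq.add (hD.memLp_sub a).integrable_sq).const_mul 3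
    rw [integral_add hI (integrable_const _), integral_const_mul,
      integral_add (hB.memLp_sub a).integrable_sq (hD.memLp_sub a).integrable_sq]
    simp only [integral_const, probReal_univ, one_smul]
    linarith

end TendstoMeanSquare

end MeanSquare

/-! ### Integrability of the singular value moments -/

section SingularValueMoments

variable {d s : ℕ} (X : Matrix (Fin d × Fin d) (Fin s) ℂ)

theorem normTrace_eq_singularValueMoment (p : ℕ) :
    normTrace X p = singularValueMoment X (2 * p) := by
  rw [normTrace_eq_sum, singularValueMoment_eq_sum]

theorem isProbabilityMeasure_empiricalSingularValueDist (hd : 0 < d)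
    (A : Matrix (Fin d × Fin d) (Fin d × Fin d) ℂ) :
    IsProbabilityMeasure (empiricalSingularValueDist A) := by
  constructor
  have hd' : ((d : ℝ≥0∞) ^ 2) ≠ 0 := by simp; omega
  simp [empiricalSingularValueDist, ENNReal.inv_mul_cancel hd' (by simp)]

theorem integrable_pow_empiricalSingularValueDist (hd : 0 < d)
    (A : Matrix (Fin d × Fin d) (Fin d × Fin d) ℂ) (k : ℕ) :
    Integrable (fun x => x ^ k) (empiricalSingularValueDist A) := by
  refine Integrable.smul_measure ?_ (by simp; omega)
  exact integrable_finsetSum_measure.2 fun i _ => integrable_dirac (by simp)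

theorem ae_nonneg_empiricalSingularValueDist (A : Matrix (Fin d × Fin d) (Fin d × Fin d) ℂ) :
    ∀ᵐ x ∂(empiricalSingularValueDist A), 0 ≤ x := by
  refine Measure.ae_smul_measure ?_ _
  rw [ae_iff, Measure.finsetSum_apply]
  refine Finset.sum_eq_zero fun i _ => ?_
  rw [← ae_iff, ae_dirac_iff measurableSet_Ici]
  exact singularValue_nonneg A i

theorem abs_singularValueMoment_sub_le (hd : 0 < d) {k N : ℕ} {r : Polynomial ℝ} {η₁ η₂ : ℝ}
    (h : ∀ y, 0 ≤ y → |√y ^ k - r.eval y| ≤ η₁ + η₂ * y ^ N) :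
    |singularValueMoment X k - ∑ i ∈ Finset.range (r.natDegree + 1), r.coeff i * normTrace X i| ≤
      η₁ + η₂ * normTrace X N := by
  have := isProbabilityMeasure_empiricalSingularValueDist hd (Q X)
  simp only [normTrace_eq_singularValueMoment]
  exact abs_integral_pow_sub_le (ae_nonneg_empiricalSingularValueDist _)
    (integrable_pow_empiricalSingularValueDist hd _) h

/-- Serves for measurability: it exhibits the moment as a pointwise limit of combinations of traces.
The n-th polynomial is within 1/(n+1) on [0,n], an interval that eventually contains every squared
singular value. -/
theorem exists_tendsto_sum_normTrace (k : ℕ) : ∃ r : ℕ → Polynomial ℝ,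
    ∀ {d s : ℕ} (X : Matrix (Fin d × Fin d) (Fin s) ℂ), Tendsto (fun n =>
      ∑ i ∈ Finset.range ((r n).natDegree + 1), (r n).coeff i * normTrace X i) atTop
      (𝓝 (singularValueMoment X k)) := by
  have h := fun n : ℕ => exists_polynomial_near_of_continuousOn 0 n (fun y => √y ^ k)
    (by fun_prop) (1 / ((n : ℝ) + 1)) (by positivity)
  choose r hr using h
  refine ⟨r, fun {d s} X => ?_⟩
  have h1 : ∀ n, ∑ i ∈ Finset.range ((r n).natDegree + 1), (r n).coeff i * normTrace X i =
      1 / (d : ℝ) ^ 2 * ∑ j, (r n).eval (singularValue (Q X) j ^ 2) := by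
    intro n
    simp only [normTrace_eq_sum, Polynomial.eval_eq_sum_range]
    rw [Finset.sum_comm, Finset.mul_sum]
    refine Finset.sum_congr rfl fun i _ => ?_
    simp only [← Finset.mul_sum, pow_mul]
    ring
  simp only [h1, singularValueMoment_eq_sum]
  refine Tendsto.const_mul _ (tendsto_finsetSum _ fun j _ => ?_)
  rw [tendsto_iff_dist_tendsto_zero]
  refine squeeze_zero' (Eventually.of_forall fun n => dist_nonneg) ?_
    (tendsto_one_div_add_atTop_nhds_zero_nat (𝕜 := ℝ))
  filter_upwards [tendsto_natCast_atTop_atTop.eventually_ge_atTop (singularValue (Q X) j ^ 2)]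
    with n hn
  have := hr n (singularValue (Q X) j ^ 2) ⟨by positivity, hn⟩
  rw [Real.sqrt_sq (singularValue_nonneg _ _)] at this
  exact this.le

/-- From σ^k ≤ 1 + σ^{2k}; square-integrability then follows from that of the trace. -/
theorem abs_singularValueMoment_le (k : ℕ) : |singularValueMoment X k| ≤ 1 + normTrace X k := by
  rw [singularValueMoment_eq_sum, normTrace_eq_sum, abs_of_nonneg (mul_nonneg (by positivity)
    (Finset.sum_nonneg fun i _ => pow_nonneg (singularValue_nonneg _ i) k))]
  have h1 : ∑ i, singularValue (Q X) i ^ k ≤ ∑ i, (1 + singularValue (Q X) i ^ (2 * k)) := by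
    refine Finset.sum_le_sum fun i _ => ?_
    rw [mul_comm, pow_mul]
    nlinarith [sq_nonneg (singularValue (Q X) i ^ k - 1),
      pow_nonneg (singularValue_nonneg (Q X) i) k]
  rw [Finset.sum_add_distrib] at h1
  simp only [Finset.sum_const, Finset.card_univ, Fintype.card_fin, nsmul_eq_mul, mul_one,
    Nat.cast_pow] at h1
  refine (mul_le_mul_of_nonneg_left h1 (by positivity)).trans ?_
  rw [mul_add]
  refine add_le_add ?_ le_rfl
  rw [one_div]
  exact inv_mul_le_one

variable {Ω : Type*} [MeasurableSpace Ω] {P : Measure Ω} [IsProbabilityMeasure P]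
  {X : Ω → Matrix (Fin d × Fin d) (Fin s) ℂ}

theorem memLp_singularValueMoment (hX : IsGaussianMatrix X P) (k : ℕ) :
    MemLp (fun ω => singularValueMoment (X ω) k) 2 P := by
  have hm : AEStronglyMeasurable (fun ω => singularValueMoment (X ω) k) P := by
    obtain ⟨r, hr⟩ := exists_tendsto_sum_normTrace k
    refine aestronglyMeasurable_of_tendsto_ae atTop (f := fun n ω =>
      ∑ i ∈ Finset.range ((r n).natDegree + 1), (r n).coeff i * normTrace (X ω) i) (fun n => ?_)
      (Eventually.of_forall fun ω => hr (X ω))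
    exact Finset.aestronglyMeasurable_fun_sum _ fun i _ =>
      (memLp_normTrace hX i 2).aestronglyMeasurable.const_mul _
  refine ((memLp_const (1 : ℝ)).add (memLp_normTrace hX k 2)).mono hm
    (Eventually.of_forall fun ω => ?_)
  exact (abs_singularValueMoment_le (X ω) k).trans (le_abs_self _)

end SingularValueMoments

/-! ### Convergence of traces and of singular value moments -/

section MainTheorem

variable {Ω : ℕ → ℕ → Type*} [∀ d s, MeasurableSpace (Ω d s)]
  {P : ∀ d s, Measure (Ω d s)} [∀ d s, IsProbabilityMeasure (P d s)]
  {X : ∀ d s, Ω d s → Matrix (Fin d × Fin d) (Fin s) ℂ}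

theorem tendsto_integral_prod_normTrace (hX : ∀ d s, IsGaussianMatrix (X d s) (P d s))
    (L : List ℕ) :
    Tendsto (fun ds : ℕ × ℕ => ∫ ω, (L.map (normTrace (X ds.1 ds.2 ω))).prod ∂(P ds.1 ds.2))
      (atTop ×ˢ atTop) (𝓝 ((L.map fun p => (catalan p : ℝ)).prod)) := by
  simp only [integral_prod_normTrace (hX _ _)]
  exact tendsto_entryExpectation_prod_tracePoly
    (ζ := fun d s (v : (Fin d × Fin d) × Fin s) ω => X d s ω v.1 v.2)
    (fun d s v => (hX d s).law v.1 v.2) (fun d s => (hX d s).indep) L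

theorem tendstoMeanSquare_normTrace (hX : ∀ d s, IsGaussianMatrix (X d s) (P d s)) (p : ℕ) :
    TendstoMeanSquare (fun ds : ℕ × ℕ => P ds.1 ds.2) (atTop ×ˢ atTop)
      (fun ds ω => normTrace (X ds.1 ds.2 ω) p) (catalan p) where
  memLp ds := memLp_normTrace (hX _ _) p 2
  tendsto := by
    -- With Y the trace and C its limit, E(Y - C)² is expanded. The second moment tends to C²
    -- because the limit for `[p, p]` factors, so everything cancels.
    have h1 := tendsto_integral_prod_normTrace hX [p, p]
    have h2 := tendsto_integral_prod_normTrace hX [p]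
    simp only [List.map_cons, List.map_nil, List.prod_cons, List.prod_nil, mul_one] at h1 h2
    have h3 := (h1.sub (h2.const_mul (2 * (catalan p : ℝ)))).add_const ((catalan p : ℝ) ^ 2)
    have h4 : (catalan p : ℝ) * catalan p - 2 * catalan p * catalan p + (catalan p : ℝ) ^ 2 = 0 := by
      ring
    rw [h4] at h3
    refine h3.congr fun ds => ?_
    have m := memLp_normTrace (hX ds.1 ds.2) p 2
    have i1 : Integrable (fun ω => normTrace (X ds.1 ds.2 ω) p * normTrace (X ds.1 ds.2 ω) p)
        (P ds.1 ds.2) := by simpa [sq] using m.integrable_sq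
    have i2 := (m.integrable one_le_two).const_mul (2 * (catalan p : ℝ))
    rw [← integral_const_mul, ← integral_sub i1 i2]
    have h5 : (catalan p : ℝ) ^ 2 = ∫ _, (catalan p : ℝ) ^ 2 ∂(P ds.1 ds.2) := by simp
    conv_lhs => rw [h5]
    have i3 : Integrable (fun ω => normTrace (X ds.1 ds.2 ω) p * normTrace (X ds.1 ds.2 ω) p -
        2 * catalan p * normTrace (X ds.1 ds.2 ω) p) (P ds.1 ds.2) := i1.sub i2
    rw [← integral_add i3 (integrable_const _)]
    congr 1
    funext ω
    ring

theorem tendstoMeanSquare_singularValueMoment (hX : ∀ d s, IsGaussianMatrix (X d s) (P d s))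
    (k : ℕ) :
    TendstoMeanSquare (fun ds : ℕ × ℕ => P ds.1 ds.2) (atTop ×ˢ atTop)
      (fun ds ω => singularValueMoment (X ds.1 ds.2 ω) k) (∫ x, x ^ k ∂quarterCircle) := by
  refine .of_approx (fun ds => memLp_singularValueMoment (hX _ _) k) fun δ hδ => ?_
  obtain ⟨r, N, η₁, η₂, hr, hη⟩ := exists_polynomial_approx k hδ
  -- The approximant is a fixed combination of traces, and the dominating variable is η₁ + η₂ times
  -- the N-th trace, whose limit η₁ + η₂ Cat_N is below δ. The same inequality for the
  -- quarter-circle law compares the two limits.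
  refine ⟨_, _, _, _, .sum (Finset.range (r.natDegree + 1)) fun i _ =>
      (tendstoMeanSquare_normTrace hX i).const_mul (r.coeff i),
    (TendstoMeanSquare.const η₁).add ((tendstoMeanSquare_normTrace hX N).const_mul η₂),
    ?_, ?_, hη⟩
  · filter_upwards [tendsto_fst.eventually (eventually_gt_atTop 0)] with ds hd ω
    exact abs_singularValueMoment_sub_le _ hd hr
  · have := abs_integral_pow_sub_le ae_nonneg_quarterCircle
      (fun k => integrable_quarterCircle (continuous_pow k)) hr
    simpa only [integral_pow_quarterCircle] using this

end MainTheorem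

end RealignedWishart

end

theorem mainTheorem2
    {Ω : ℕ → ℕ → Type*} [∀ d s, MeasurableSpace (Ω d s)]
    (P : ∀ d s, Measure (Ω d s)) [∀ d s, IsProbabilityMeasure (P d s)]
    (X : ∀ d s, Ω d s → Matrix (Fin d × Fin d) (Fin s) ℂ)
    (hX : ∀ d s, RealignedWishart.IsGaussianMatrix (X d s) (P d s)) :
    (∀ p : ℕ,
      (∀ d s, MemLp (fun ω => RealignedWishart.normTrace (X d s ω) p) 2 (P d s)) ∧
      Tendsto (fun ds : ℕ × ℕ =>
          ∫ ω, RealignedWishart.normTrace (X ds.1 ds.2 ω) p ∂(P ds.1 ds.2))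
        (atTop ×ˢ atTop) (𝓝 (catalan p : ℝ)) ∧
      Tendsto (fun ds : ℕ × ℕ =>
          variance (fun ω => RealignedWishart.normTrace (X ds.1 ds.2 ω) p) (P ds.1 ds.2))
        (atTop ×ˢ atTop) (𝓝 0)) ∧
    (∀ k : ℕ,
      (∀ d s, MemLp (fun ω => RealignedWishart.singularValueMoment (X d s ω) k) 2 (P d s)) ∧
      Tendsto (fun ds : ℕ × ℕ =>
          ∫ ω, RealignedWishart.singularValueMoment (X ds.1 ds.2 ω) k ∂(P ds.1 ds.2))
        (atTop ×ˢ atTop) (𝓝 (∫ x, x ^ k ∂(RealignedWishart.quarterCircle))) ∧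
      Tendsto (fun ds : ℕ × ℕ =>
          variance (fun ω => RealignedWishart.singularValueMoment (X ds.1 ds.2 ω) k)
            (P ds.1 ds.2))
        (atTop ×ˢ atTop) (𝓝 0)) :=
  ⟨fun p => ⟨fun d s => RealignedWishart.memLp_normTrace (hX d s) p 2,
      (RealignedWishart.tendstoMeanSquare_normTrace hX p).tendsto_mean,
      (RealignedWishart.tendstoMeanSquare_normTrace hX p).tendsto_variance⟩,
    fun k => ⟨fun d s => RealignedWishart.memLp_singularValueMoment (hX d s) k,
      (RealignedWishart.tendstoMeanSquare_singularValueMoment hX k).tendsto_mean,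
      (RealignedWishart.tendstoMeanSquare_singularValueMoment hX k).tendsto_variance⟩⟩
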